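/- **Notation.** For $n\ge 1$ let $[n]=\{0,\dots,n-1\}$ and $V_n=\{0,1\}^{[n]}$, let $\oplus$ be coordinatewise addition modulo $2$, $e_i\in V_n$ the $i$-th unit vector, and $Q_n$ the graph on $V_n$ in which $\alpha,\beta$ are adjacent iff $\alpha\oplus\beta=e_j$ for some $j\in[n]$. Put $\chi(\alpha)=\prod_{j}(-1)^{\alpha(j)}$. A pair $\{\alpha,\beta\}$ is *odd* if $\chi(\alpha)\ne\chi(\beta)$, and an *edge-pair* if it is an edge of $Q_n$. An *odd pair-set* in $Q_n$ is a (possibly empty) set $A$ of pairwise disjoint odd pairs of vertices of $Q_n$; $\bigcup A$ is the set of all vertices in its pairs. For $X\subseteq V_n$ let $\mathrm{enc}(X)$ be the set of all vertices outside $X$ all of whose neighbours lie in $X$. For $i\in[n]$ let $\sigma_i(A)=(n_0,n_1)$, where $n_k$ is the number of $\{\alpha,\beta\}\in A$ with $\alpha(i)=\beta(i)=k$. Let $\rho_{i=k}(A)$ be the set of pairs in $Q_{n-1}$ obtained from these $n_k$ pairs by deleting the $i$-th coordinate. An odd pair-set $A$ in $Q_n$ is *diminishable* if either * $|A|\le n-1$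 and, in case $n=4$, $A$ contains an edge-pair or there is no $X$ with $\bigcup A\subseteq X\subseteq V_4$ whose induced subgraph of $Q_4$ is isomorphic to $Q_3$; or * $|A|=n\ne 4$, $A$ contains at least two edge-pairs, and $\mathrm{enc}(\bigcup A)=\emptyset$. Let $A$ be diminishable with $|A|=n$. An index $i\in[n]$ is *separating* for $A$ if there are edge-pairs $\{\alpha,\beta\},\{\alpha',\beta'\}\in A$ with $\alpha(i)=\beta(i)\ne\alpha'(i)=\beta'(i)$. It is *bad* for $A$ if it is separating and, with $\sigma_i(A)=(n_0,n_1)$, there are $k\in\{0,1\}$ with $n_k=n-3$, $n_{1-k}=1$ and distinct pairs $\{\alpha_l,\beta_l\}\in A$ ($l=0,1,2$) such that $\alpha_0(i)=\alpha_1(i)=k\ne\beta_0(i)=\beta_1(i)=\alpha_2(i)=\beta_2(i)$, $\chi(\alpha_0)\ne\chi(\alpha_1)$, and for each $j\in\{0,1\}$ every neighbour $\kappa$ of $\alpha_j$ with $\kappa(i)=k$ satisfies $$\kappa\in\bigcup\bigl(A\setminus\{\{\alpha_l,\beta_l\}:l=0,1,2\}\bigr)\quad\text{or}\quad\kappa=\alpha_{1-j}\quad\text{or}\quad\kappa\oplus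 e_i\in\{\alpha_2,\beta_0,\beta_1,\beta_2\}.$$ A *simple $i$-completion* of a nonempty odd pair-set $A$ is any set $B$ that can be obtained as follows. Start with $B=\emptyset$ and treat the pairs of $A$ one after another, in any order. If $\alpha(i)=\beta(i)$, add $\{\alpha,\beta\}$ to $B$. If $\alpha(i)\ne\beta(i)$, choose $\gamma\in V_n$ with $\gamma(i)=\alpha(i)$, $\chi(\gamma)\ne\chi(\alpha)$ and $\gamma,\gamma\oplus e_i\notin\bigcup A\cup\bigcup B$ (for the current $B$), and add $\{\alpha,\gamma\}$ and $\{\gamma\oplus e_i,\beta\}$ to $B$. Here either vertex of the treated pair may be called $\alpha$. Every such $\gamma$ must exist, that is, all pairs of $A$ get treated. **Proposition.** (1) Let $n\ge 6$, let $i\in[n]$, let $A$ be a diminishable odd pair-set in $Q_n$, and let $\sigma_i(A)=(n_0,n_1)$. Assume that * either $|A|\le n-1$, $n_0\le|A|-3$, $n_1\le |A|-3$, and, in case $n=6$ and $|A|=5$, also $(n_0,n_1)\ne(0,0)$; * or $|A|=n$, $1\le n_0\le n-3$, $1\le n_1\le n-3$, and $i$ is separating for $A$ and not bad for $A$. Then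 there is a simple $i$-completion $B$ of $A$ such that $\rho_{i=0}(B)$ and $\rho_{i=1}(B)$ are both diminishable in $Q_{n-1}$. (2) Let $A$ be a diminishable odd pair-set in $Q_6$ with $|A|=5$. Then for some $i\in[6]$, with $\sigma_i(A)=(n_0,n_1)$, either $\max\{n_0,n_1\}\ge 3$ or there is a simple $i$-completion $B$ of $A$ such that $\rho_{i=0}(B)$ and $\rho_{i=1}(B)$ are both diminishable in $Q_5$. -/

import Mathlib

namespace HypercubePairs

/-- Vertices of the hypercube: `(0,1)`-vectors of length `n`. Coordinatewise addition modulo `2`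
is the exclusive or of vectors. -/
abbrev Vert (n : ℕ) : Type := Fin n → ZMod 2

/-- The unit vector `e_i`. -/
abbrev unitVec {n : ℕ} (i : Fin n) : Vert n := Pi.single i 1

/-- The hypercube `Q_n`. -/
def hypercube (n : ℕ) : SimpleGraph (Vert n) where
  Adj α β := ∃ i : Fin n, α + β = unitVec i
  symm := ⟨fun α β ⟨i, h⟩ => ⟨i, by rw [add_comm, h]⟩⟩
  loopless := ⟨fun α ⟨i, h⟩ => by
    have h1 := congrFun h i
    rw [unitVec, Pi.add_apply, CharTwo.add_self_eq_zero, Pi.single_eq_same] at h1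
    exact zero_ne_one h1⟩

/-- The parity `χ(α) = ∏ (-1)^{α(i)}`, equal to `1` or `-1`. -/
def parity {n : ℕ} (α : Vert n) : ℤ := ∏ i, (-1) ^ (α i).val

/-- Pairs are two-element multisets of vertices. -/
abbrev Pair (n : ℕ) : Type := Sym2 (Vert n)

/-- `χ(α, β) = χ(α) + χ(β)`. -/
def pairParity {n : ℕ} (p : Pair n) : ℤ :=
  Sym2.lift ⟨fun α β => parity α + parity β, fun _ _ => add_comm _ _⟩ p

/-- A pair `{α, β}` is odd if `χ(α) ≠ χ(β)`. -/
def IsOddPair {n : ℕ} (p : Pair n) : Prop :=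
  Sym2.lift ⟨fun α β => parity α ≠ parity β, fun _ _ => propext ne_comm⟩ p

/-- A pair `{α, β}` is even if `χ(α) = χ(β)`. -/
def IsEvenPair {n : ℕ} (p : Pair n) : Prop := ¬ IsOddPair p

/-- An edge-pair is a pair that is an edge of the hypercube. -/
def IsEdgePair {n : ℕ} (p : Pair n) : Prop := p ∈ (hypercube n).edgeSet

/-- Distinct members of a pair-set are disjoint, and a nonempty pair-set has a nondegenerate
member. -/
def IsPairSet {n : ℕ} (A : Finset (Pair n)) : Prop :=
  (∀ p ∈ A, ∀ q ∈ A, p ≠ q → ∀ v ∈ p, v ∉ q) ∧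
    (A.Nonempty → ∃ p ∈ A, ¬ p.IsDiag)

/-- The set `⋃ A` of all vertices that occur in pairs of `A`. -/
def verts {n : ℕ} (A : Finset (Pair n)) : Set (Vert n) := {v | ∃ p ∈ A, v ∈ p}

/-- Balanced pair-sets. -/
def IsBalanced {n : ℕ} (A : Finset (Pair n)) : Prop :=
  IsPairSet A ∧ ∑ p ∈ A, pairParity p = 0

/-- Odd pair-sets. -/
def IsOdd {n : ℕ} (A : Finset (Pair n)) : Prop :=
  IsPairSet A ∧ ∀ p ∈ A, IsOddPair p

/-- The vertices outside of `X` that are encompassed by `X`, that is, all of whose neighbours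
lie in `X`. -/
def enc {n : ℕ} (X : Set (Vert n)) : Set (Vert n) :=
  {α | α ∉ X ∧ ∀ β, (hypercube n).Adj α β → β ∈ X}

/-- The pairs `{α, β} ∈ A` with `α(i) = β(i) = k`. -/
def side {n : ℕ} (i : Fin n) (k : ZMod 2) (A : Finset (Pair n)) : Finset (Pair n) :=
  A.filter (fun p => ∀ v ∈ p, v i = k)

/-- `σ_i(A) = (n₀, n₁)`, where `n_k` is the number of `{α, β} ∈ A` with `α(i) = β(i) = k`. -/
def sigma {n : ℕ} (i : Fin n) (A : Finset (Pair n)) : ℕ × ℕ :=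
  ((side i 0 A).card, (side i 1 A).card)

/-- The half `ρ_{i=k}(A)`: the pairs of `A` inside the subcube given by the `i`-th coordinate
being `k`, with the `i`-th coordinate deleted. -/
def rho {m : ℕ} (i : Fin (m + 1)) (k : ZMod 2) (A : Finset (Pair (m + 1))) : Finset (Pair m) :=
  (side i k A).image (Sym2.map fun α : Vert (m + 1) => i.removeNth α)

/-- Diminishable pair-sets. -/
def IsDiminishable {n : ℕ} (A : Finset (Pair n)) : Prop :=
  IsOdd A ∧
    ((A.card + 1 ≤ n ∧
        (n = 4 → (∃ p ∈ A, IsEdgePair p) ∨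
          ¬ ∃ X : Set (Vert n), verts A ⊆ X ∧
            Nonempty ((hypercube n).induce X ≃g hypercube 3))) ∨
      (A.card = n ∧ n ≠ 4 ∧
        (∃ p ∈ A, ∃ q ∈ A, p ≠ q ∧ IsEdgePair p ∧ IsEdgePair q) ∧
        enc (verts A) = ∅))

/-- `i` is separating for `A`: the set `A` has edge-pairs on both sides of the `i`-th
coordinate. -/
def IsSeparating {n : ℕ} (i : Fin n) (A : Finset (Pair n)) : Prop :=
  ∃ α β α' β' : Vert n, s(α, β) ∈ A ∧ s(α', β') ∈ A ∧
    IsEdgePair s(α, β) ∧ IsEdgePair s(α', β') ∧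
    α i = β i ∧ α' i = β' i ∧ α i ≠ α' i

/-- `i` is bad for `A`. -/
def IsBad {n : ℕ} (i : Fin n) (A : Finset (Pair n)) : Prop :=
  A.card = n ∧ IsSeparating i A ∧
  ∃ k : ZMod 2, (side i k A).card + 3 = n ∧ (side i (1 - k) A).card = 1 ∧
  ∃ α₀ β₀ α₁ β₁ α₂ β₂ : Vert n,
    s(α₀, β₀) ∈ A ∧ s(α₁, β₁) ∈ A ∧ s(α₂, β₂) ∈ A ∧
    s(α₀, β₀) ≠ s(α₁, β₁) ∧ s(α₀, β₀) ≠ s(α₂, β₂) ∧ s(α₁, β₁) ≠ s(α₂, β₂) ∧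
    α₀ i = k ∧ α₁ i = k ∧
    β₀ i = 1 - k ∧ β₁ i = 1 - k ∧ α₂ i = 1 - k ∧ β₂ i = 1 - k ∧
    parity α₀ ≠ parity α₁ ∧
    (∀ κ : Vert n, κ i = k → (hypercube n).Adj κ α₀ →
      κ ∈ verts (A \ {s(α₀, β₀), s(α₁, β₁), s(α₂, β₂)}) ∨ κ = α₁ ∨
        κ + unitVec i ∈ ({α₂, β₀, β₁, β₂} : Set (Vert n))) ∧
    (∀ κ : Vert n, κ i = k → (hypercube n).Adj κ α₁ →
      κ ∈ verts (A \ {s(α₀, β₀), s(α₁, β₁), s(α₂, β₂)}) ∨ κ = α₀ ∨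
        κ + unitVec i ∈ ({α₂, β₀, β₁, β₂} : Set (Vert n)))

/-- An `(A, i)`-matching: a perfect matching `R` on the even pairs of `A` such that matched pairs
have opposite parities, and matched degenerate pairs agree in the `i`-th coordinate. -/
def IsPairMatching {n : ℕ} (i : Fin n) (A : Finset (Pair n)) (R : Finset (Sym2 (Pair n))) : Prop :=
  (∀ r ∈ R, ∀ p ∈ r, p ∈ A ∧ IsEvenPair p) ∧
  (∀ p ∈ A, IsEvenPair p → ∃! r, r ∈ R ∧ p ∈ r) ∧
  (∀ p q : Pair n, s(p, q) ∈ R → p ≠ q ∧ pairParity p + pairParity q = 0) ∧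
  (∀ α β : Vert n, s(s(α, α), s(β, β)) ∈ R → α i = β i)

/-- `γ` is available with respect to `A` and `B` if neither `γ` nor `γ ⊕ e_i` lies in
`⋃ A ∪ ⋃ B`. -/
def IsAvailable {n : ℕ} (i : Fin n) (A B : Finset (Pair n)) (γ : Vert n) : Prop :=
  γ ∉ verts A ∪ verts B ∧ γ + unitVec i ∉ verts A ∪ verts B

/-- One step of the construction of simple `i`-completions of `A` with respect to the
`(A, i)`-matching `R`. A state `(B, A')` consists of the set `B` built so far and the set `A'` of
pairs of `A` that are still to be treated. -/
inductive CompletionStep {n : ℕ} (i : Fin n) (A : Finset (Pair n)) (R : Finset (Sym2 (Pair n))) :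
    Finset (Pair n) × Finset (Pair n) → Finset (Pair n) × Finset (Pair n) → Prop
  | oddKeep (B A' : Finset (Pair n)) (α β : Vert n)
      (hmem : s(α, β) ∈ A') (hodd : IsOddPair s(α, β)) (hi : α i = β i) :
      CompletionStep i A R (B, A') (B ∪ {s(α, β)}, A' \ {s(α, β)})
  | oddSplit (B A' : Finset (Pair n)) (α β γ : Vert n)
      (hmem : s(α, β) ∈ A') (hodd : IsOddPair s(α, β)) (hi : α i ≠ β i)
      (hγi : γ i = α i) (hγ : parity α ≠ parity γ) (hav : IsAvailable i A B γ) :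
      CompletionStep i A R (B, A')
        (B ∪ {s(α, γ), s(γ + unitVec i, β)}, A' \ {s(α, β)})
  | evenKeep (B A' : Finset (Pair n)) (α β α' β' : Vert n)
      (hmem : s(α, β) ∈ A') (hmem' : s(α', β') ∈ A') (hR : s(s(α, β), s(α', β')) ∈ R)
      (h₁ : α i = β i) (h₂ : β i = α' i) (h₃ : α' i = β' i) :
      CompletionStep i A R (B, A')
        (B ∪ {s(α, β), s(α', β')}, A' \ {s(α, β), s(α', β')})
  | evenThree (B A' : Finset (Pair n)) (α β α' β' γ : Vert n)
      (hmem : s(α, β) ∈ A') (hmem' : s(α', β') ∈ A') (hR : s(s(α, β), s(α', β')) ∈ R)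
      (h₁ : α i = β i) (h₂ : β i = α' i) (h₃ : β' i ≠ α' i)
      (hγi : γ i ≠ β' i) (hγ : parity γ = parity α') (hav : IsAvailable i A B γ) :
      CompletionStep i A R (B, A')
        (B ∪ {s(α, β), s(α', γ), s(γ + unitVec i, β')}, A' \ {s(α, β), s(α', β')})
  | evenOpposite (B A' : Finset (Pair n)) (α β α' β' γ γ' : Vert n)
      (hmem : s(α, β) ∈ A') (hmem' : s(α', β') ∈ A') (hR : s(s(α, β), s(α', β')) ∈ R)
      (h₁ : α i = β i) (h₂ : β i ≠ α' i) (h₃ : α' i = β' i) (hnd : α' ≠ β')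
      (hne : γ ≠ γ') (hγi : γ i = α' i) (hγi' : γ' i = α' i)
      (hγ : parity γ = parity γ') (hγ' : parity γ' ≠ parity α')
      (hav : IsAvailable i A B γ) (hav' : IsAvailable i A B γ') :
      CompletionStep i A R (B, A')
        (B ∪ {s(α, β), s(α', γ), s(β', γ'), s(γ + unitVec i, γ' + unitVec i)},
          A' \ {s(α, β), s(α', β')})
  | evenSplit (B A' : Finset (Pair n)) (α β α' β' γ γ' : Vert n)
      (hmem : s(α, β) ∈ A') (hmem' : s(α', β') ∈ A') (hR : s(s(α, β), s(α', β')) ∈ R)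
      (h₁ : α i ≠ β i) (h₂ : α' i ≠ β' i) (h₃ : α i = α' i)
      (hne : γ ≠ γ') (hγi : γ i = α i) (hγi' : γ' i = α i)
      (hγ : parity γ = parity α) (hγ' : parity γ' = parity α')
      (hav : IsAvailable i A B γ) (hav' : IsAvailable i A B γ') :
      CompletionStep i A R (B, A')
        (B ∪ {s(α, γ), s(α', γ'), s(γ + unitVec i, β), s(γ' + unitVec i, β')},
          A' \ {s(α, β), s(α', β')})

/-- The set `C_i(A)` of simple `i`-completions of a nonempty balanced pair-set `A`: all sets `B`
that the construction produces when it ends successfully, i.e. with no pair left to treat. -/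
def simpleCompletions {n : ℕ} (i : Fin n) (A : Finset (Pair n)) : Set (Finset (Pair n)) :=
  {B | A.Nonempty ∧ IsBalanced A ∧ ∃ R, IsPairMatching i A R ∧
    Relation.ReflTransGen (CompletionStep i A R) (∅, A) (B, ∅)}

end HypercubePairs

open HypercubePairs

/-!
After deletion of the `i`-th coordinate, a pair of `A` that crosses the `i`-th direction becomes
two vertices `a 0 j`, `a 1 j` of `Q_m` (with `n = m + 1`), which have the same parity. A simple
`i`-completion amounts to an injective choice of vertices `g j` of the opposite parity that are not
used by `A` in any of the two halves; the `k`-th half of the completion then consists of the pairs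
of `A` inside this half and of the pairs `{a k j, g j}`. This is the structure `CrossingData` with
the predicate `Valid`. A half with less than `m` pairs is diminishable for any such choice. A half
with `m` pairs needs two edge-pairs and must not encompass a vertex.

The choices are made by counting. As `m ≥ 5`, a parity class of `Q_m` has `2 ^ (m - 1) > 2 * m`
vertices, which exceeds the number of used ones, so every partial choice extends
(`Valid.exists_extension`). As two vertices have at most two common neighbours, two crossing pairs
of the same parity have together at least `2 * m - 2` candidates for an edge, and one of them can
get an edge-pair (`Valid.exists_extends_edge`).

In a half with `m` pairs, each parity class has exactly `m` used vertices, so a vertex is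
encompassed only if its neighbourhood is the whole class of the other parity. Fewer than `m`
vertices are completed to a neighbourhood by at most one vertex, hence a single free choice of
parity `-ε` prevents that vertices of parity `ε` are encompassed. In three situations a parity
without a free choice remains. If all crossing pairs have the same parity, then the one vertex that
might be encompassed is taken as a new vertex (`Valid.exists_covered`). If the crossing pairs are
two of one parity and one of the other, or one of each parity, then there are enough candidates for
edges to avoid a neighbourhood (`exists_good_two_of_three`, `exists_good_one_of_two`). In the last
case, the existence of a candidate follows from `i` not being bad (`exists_nbr_of_not_isBad`).

The second part follows from the first one: in `Q_6` antipodal vertices have equal parities, hence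
the ends of an odd pair agree in some coordinate `i`, for which `(n₀, n₁) ≠ (0, 0)`.
-/

namespace HypercubePairs

/-! ### Parity and neighbourhoods -/

section Cube

variable {m : ℕ}

theorem parity_eq_one_or (α : Vert m) : parity α = 1 ∨ parity α = -1 := by
  unfold parity
  rw [Finset.prod_pow_eq_pow_sum]
  exact neg_one_pow_eq_or ℤ _

theorem parity_eq_neg_of_ne {α β : Vert m} (h : parity α ≠ parity β) : parity α = -parity β := by
  rcases parity_eq_one_or α with ha | ha <;> rcases parity_eq_one_or β with hb | hb <;>
    simp_all

theorem parity_ne_neg (α : Vert m) : parity α ≠ -parity α := by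
  rcases parity_eq_one_or α with ha | ha <;> rw [ha] <;> decide

theorem neg_one_pow_val_add_one (x : ZMod 2) :
    (-1 : ℤ) ^ (x + 1).val = -(-1) ^ x.val := by
  revert x; decide

theorem parity_add_unitVec (α : Vert m) (i : Fin m) :
    parity (α + unitVec i) = -parity α := by
  unfold parity
  rw [← Finset.mul_prod_erase _ _ (Finset.mem_univ i),
    ← Finset.mul_prod_erase _ _ (Finset.mem_univ i)]
  have h : ∀ j ∈ Finset.univ.erase i,
      (-1 : ℤ) ^ ((α + unitVec i) j).val = (-1) ^ (α j).val := by
    intro j hj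
    simp [unitVec, Pi.single_eq_of_ne (Finset.ne_of_mem_erase hj)]
  rw [Finset.prod_congr rfl h]
  simp only [Pi.add_apply, unitVec, Pi.single_eq_same, neg_one_pow_val_add_one]
  ring

theorem parity_eq_mul_removeNth (i : Fin (m + 1)) (α : Vert (m + 1)) :
    parity α = (-1) ^ (α i).val * parity (i.removeNth α) := by
  unfold parity
  rw [Fin.prod_univ_succAbove _ i]
  rfl

theorem add_self_vert (α : Vert m) : α + α = 0 := by
  ext j; exact CharTwo.add_self_eq_zero _

/-- The neighbours of a vertex of the hypercube. -/
def nbrs (v : Vert m) : Finset (Vert m) := Finset.univ.image fun i => v + unitVec i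

theorem mem_nbrs_iff {v w : Vert m} : w ∈ nbrs v ↔ (hypercube m).Adj v w := by
  simp only [nbrs, Finset.mem_image, Finset.mem_univ, true_and, hypercube]
  refine exists_congr fun i => ⟨?_, fun h => ?_⟩
  · rintro rfl
    rw [← add_assoc, add_self_vert, zero_add]
  · rw [← h, ← add_assoc, add_self_vert, zero_add]

theorem mem_nbrs_comm {v w : Vert m} : w ∈ nbrs v ↔ v ∈ nbrs w := by
  rw [mem_nbrs_iff, mem_nbrs_iff, SimpleGraph.adj_comm]

theorem unitVec_injective : Function.Injective (unitVec : Fin m → Vert m) := by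
  intro i j h
  by_contra hne
  have := congrFun h i
  simp [unitVec, Pi.single_eq_of_ne hne] at this

theorem card_nbrs (v : Vert m) : (nbrs v).card = m := by
  rw [nbrs, Finset.card_image_of_injective, Finset.card_univ, Fintype.card_fin]
  exact fun i j h => unitVec_injective (add_left_cancel h)

theorem parity_of_mem_nbrs {v w : Vert m} (h : w ∈ nbrs v) : parity w = -parity v := by
  obtain ⟨i, -, rfl⟩ := Finset.mem_image.1 h
  exact parity_add_unitVec v i

theorem card_nbrs_inter_le {v w : Vert m} (h : v ≠ w) : (nbrs v ∩ nbrs w).card ≤ 2 := by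
  rcases (nbrs v ∩ nbrs w).eq_empty_or_nonempty with h0 | ⟨x, hx⟩
  · simp [h0]
  obtain ⟨i, -, hi⟩ := Finset.mem_image.1 (Finset.mem_inter.1 hx).1
  obtain ⟨j, -, hj⟩ := Finset.mem_image.1 (Finset.mem_inter.1 hx).2
  have hw : w = v + unitVec i + unitVec j := by
    rw [hi, ← hj, add_assoc, add_self_vert, add_zero]
  refine (Finset.card_le_card (t := {v + unitVec i, v + unitVec j}) ?_).trans Finset.card_le_two
  intro y hy
  obtain ⟨k, -, rfl⟩ := Finset.mem_image.1 (Finset.mem_inter.1 hy).1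
  obtain ⟨l, -, hl⟩ := Finset.mem_image.1 (Finset.mem_inter.1 hy).2
  simp only [Finset.mem_insert, Finset.mem_singleton]
  by_contra! hcon
  have hki : k ≠ i := fun h => hcon.1 (by rw [h])
  have hkj : k ≠ j := fun h => hcon.2 (by rw [h])
  have hkl : k ≠ l := by
    rintro rfl
    exact h (add_right_cancel hl).symm
  have := congrFun hl k
  simp [hw, unitVec, Pi.single_eq_of_ne hki, Pi.single_eq_of_ne hkj, Pi.single_eq_of_ne hkl] at this

theorem card_union_nbrs_ge {v w : Vert m} (h : v ≠ w) :
    2 * m ≤ (nbrs v ∪ nbrs w).card + 2 := by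
  have h1 := Finset.card_union_add_card_inter (nbrs v) (nbrs w)
  rw [card_nbrs, card_nbrs] at h1
  have := card_nbrs_inter_le h
  omega

/-- A vertex is determined by any three of its neighbours. -/
theorem eq_of_subset_nbrs {Y : Finset (Vert m)} (hY : 3 ≤ Y.card) {v w : Vert m}
    (hv : Y ⊆ nbrs v) (hw : Y ⊆ nbrs w) : v = w := by
  by_contra h
  have := Finset.card_le_card (Finset.subset_inter hv hw)
  have := card_nbrs_inter_le h
  omega

theorem two_mul_card_parity (hm : 0 < m) {ε : ℤ} (hε : ε = 1 ∨ ε = -1) :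
    2 * (Finset.univ.filter fun v : Vert m => parity v = ε).card = 2 ^ m := by
  have hsym : (Finset.univ.filter fun v : Vert m => parity v = ε).card =
      (Finset.univ.filter fun v : Vert m => ¬ parity v = ε).card := by
    refine Finset.card_nbij' (fun v => v + unitVec ⟨0, hm⟩) (fun v => v + unitVec ⟨0, hm⟩)
      ?_ ?_ ?_ ?_
    · intro v hv
      have hv : parity v = ε := by simpa using hv
      simp only [Finset.coe_filter, Finset.mem_univ, true_and, Set.mem_ofPred_eq,
        parity_add_unitVec, hv]
      rcases hε with rfl | rfl <;> decide
    · intro v hv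
      have hv : parity v ≠ ε := by simpa using hv
      simp only [Finset.coe_filter, Finset.mem_univ, true_and, Set.mem_ofPred_eq,
        parity_add_unitVec]
      rcases parity_eq_one_or v with h | h <;> rcases hε with rfl | rfl <;> simp_all
    · intro v _
      simp only [add_assoc, add_self_vert, add_zero]
    · intro v _
      simp only [add_assoc, add_self_vert, add_zero]
  have htot := Finset.card_filter_add_card_filter_not (s := (Finset.univ : Finset (Vert m)))
    (fun v => parity v = ε)
  have : (Finset.univ : Finset (Vert m)).card = 2 ^ m := by
    simp [Finset.card_univ]
  omega

theorem two_mul_lt_card_parity (hm : 5 ≤ m) {ε : ℤ} (hε : ε = 1 ∨ ε = -1) :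
    2 * m < (Finset.univ.filter fun v : Vert m => parity v = ε).card := by
  have h1 := two_mul_card_parity (by omega : 0 < m) hε
  have h2 : ∀ k, 4 * (k + 5) < 2 ^ (k + 5) := by
    intro k
    induction k with
    | zero => norm_num
    | succ k ih => rw [show k + 1 + 5 = k + 5 + 1 by ring, pow_succ]; omega
  have := h2 (m - 5)
  rw [Nat.sub_add_cancel hm] at this
  omega

theorem subset_nbrs_of_nbrs_subset_union {Y D : Finset (Vert m)} {v : Vert m}
    (hY : Y.card + D.card ≤ m) (h : nbrs v ⊆ Y ∪ D) : Y ⊆ nbrs v := by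
  have h1 : (Y ∪ D).card ≤ (nbrs v).card := by
    rw [card_nbrs]; exact (Finset.card_union_le _ _).trans hY
  rw [Finset.eq_of_subset_of_card_le h h1]
  exact Finset.subset_union_left

/-- A set with fewer than `m` vertices can be completed to a set containing a neighbourhood by
at most one vertex. -/
theorem exists_forall_ne_not_nbrs_subset (hm : 4 ≤ m) {Y : Finset (Vert m)} (hY : Y.card < m) :
    ∃ x₀, ∀ x, x ≠ x₀ → ∀ v, ¬ nbrs v ⊆ insert x Y := by
  by_contra! hcon
  obtain ⟨x, -, v, hv⟩ := hcon 0
  obtain ⟨x', hne, v', hv'⟩ := hcon x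
  have key : ∀ x v, nbrs v ⊆ insert x Y → Y ⊆ nbrs v ∧ x ∈ nbrs v := by
    intro x v h
    refine ⟨subset_nbrs_of_nbrs_subset_union (D := {x}) (by simp; omega)
      (by rwa [Finset.union_comm]), ?_⟩
    by_contra hx
    have := Finset.card_le_card ((Finset.subset_insert_iff_of_notMem hx).1 h)
    rw [card_nbrs] at this
    omega
  have hYc : 3 ≤ Y.card := by
    have := (Finset.card_le_card hv).trans (Finset.card_insert_le _ _)
    rw [card_nbrs] at this
    omega
  obtain rfl := eq_of_subset_nbrs hYc (key x v hv).1 (key x' v' hv').1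
  have hx' : x' ∈ Y := by
    rcases Finset.mem_insert.1 (hv (key x' v hv').2) with h | h
    · exact absurd h hne
    · exact h
  rw [Finset.insert_eq_of_mem hx'] at hv'
  have := Finset.card_le_card hv'
  rw [card_nbrs] at this
  omega

end Cube

/-! ### Choosing the new vertices: partial choices and their extension -/

theorem zmod_two_eq (k : ZMod 2) : k = 0 ∨ k = 1 := by
  revert k; decide

theorem zmod_two_eq_or_eq_add_one (k k' : ZMod 2) : k' = k ∨ k' = k + 1 := by
  revert k k'; decide

/-- The data of a simple completion after deletion of the `i`-th coordinate. The index type `ι`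
enumerates the pairs that cross the `i`-th direction. `P k` is the set of vertices of the pairs
inside the `k`-th half, where every parity class has at most `n k` of them, and `a k j` is the end
of the `j`-th crossing pair in that half. Both ends of a crossing pair get the same parity `par j`,
as the deleted coordinate distinguishes them. -/
structure CrossingData (m : ℕ) (ι : Type) [Fintype ι] where
  le_dim : 5 ≤ m
  P : ZMod 2 → Finset (Vert m)
  a : ZMod 2 → ι → Vert m
  par : ι → ℤ
  n : ZMod 2 → ℕ
  parity_a : ∀ k j, parity (a k j) = par j
  a_injective : ∀ k, Function.Injective (a k)
  card_P_le : ∀ k ε, ε = 1 ∨ ε = -1 → ((P k).filter fun v => parity v = ε).card ≤ n k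
  card_le : ∀ k, n k + Fintype.card ι ≤ m

namespace CrossingData

variable {m : ℕ} {ι : Type} [Fintype ι] (D : CrossingData m ι)

/-- The vertices of the `k`-th half that are used by the given pairs. -/
def U (k : ZMod 2) : Finset (Vert m) := D.P k ∪ Finset.univ.image (D.a k)

/-- The forbidden vertices: those used in at least one of the two halves. -/
def F : Finset (Vert m) := D.U 0 ∪ D.U 1

/-- The vertices of the `k`-th half that are used after the choice `g` of new vertices. -/
def X (k : ZMod 2) (g : ι → Vert m) : Finset (Vert m) := D.U k ∪ Finset.univ.image g

/-- The number of crossing pairs whose ends have parity `ε`. -/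
def c (ε : ℤ) : ℕ := (Finset.univ.filter fun j => D.par j = ε).card

/-- The values of `g` on `S` are admissible new vertices for the crossing pairs in `S`. -/
structure Valid (S : Finset ι) (g : ι → Vert m) : Prop where
  notMem : ∀ j ∈ S, g j ∉ D.F
  parity_eq : ∀ j ∈ S, parity (g j) = -D.par j
  injOn : Set.InjOn g S

theorem par_eq (j : ι) : D.par j = 1 ∨ D.par j = -1 := by
  rw [← D.parity_a 0 j]; exact parity_eq_one_or _

theorem par_eq_or {ε : ℤ} (hε : ε = 1 ∨ ε = -1) (j : ι) : D.par j = ε ∨ D.par j = -ε := by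
  rcases hε with rfl | rfl <;> rcases D.par_eq j with h | h <;> simp [h]

theorem c_add_c_neg {ε : ℤ} (hε : ε = 1 ∨ ε = -1) : D.c ε + D.c (-ε) = Fintype.card ι := by
  have h := Finset.card_filter_add_card_filter_not (s := (Finset.univ : Finset ι))
    (fun j => D.par j = ε)
  rw [Finset.card_univ] at h
  rw [← h, c, c]
  congr 2
  ext j
  have := D.par_eq_or hε j
  simp only [Finset.mem_filter, Finset.mem_univ, true_and]
  constructor
  · rintro h rfl
    rcases hε with h1 | h1 <;> rw [h1] at h <;> revert h <;> decide
  · intro h; tauto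

theorem U_subset_F (k : ZMod 2) : D.U k ⊆ D.F := by
  rcases zmod_two_eq k with rfl | rfl
  · exact Finset.subset_union_left
  · exact Finset.subset_union_right

theorem a_mem_U (k : ZMod 2) (j : ι) : D.a k j ∈ D.U k :=
  Finset.mem_union_right _ (Finset.mem_image_of_mem _ (Finset.mem_univ j))

theorem mem_F_iff (k : ZMod 2) {v : Vert m} : v ∈ D.F ↔ v ∈ D.U k ∨ v ∈ D.U (k + 1) := by
  rcases zmod_two_eq k with rfl | rfl
  · exact Finset.mem_union
  · rw [show (1 : ZMod 2) + 1 = 0 by decide, or_comm]; exact Finset.mem_union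

theorem n_add_n (k : ZMod 2) : D.n k + D.n (k + 1) = D.n 0 + D.n 1 := by
  rcases zmod_two_eq k with rfl | rfl
  · rfl
  · rw [show (1 : ZMod 2) + 1 = 0 by decide, add_comm]

theorem card_image_a_filter_le (k : ZMod 2) (ε : ℤ) :
    ((Finset.univ.image (D.a k)).filter fun v => parity v = ε).card ≤ D.c ε := by
  rw [Finset.filter_image]
  refine Finset.card_image_le.trans (le_of_eq ?_)
  simp only [D.parity_a, c]

theorem card_U_filter_le (k : ZMod 2) {ε : ℤ} (hε : ε = 1 ∨ ε = -1) :
    ((D.U k).filter fun v => parity v = ε).card ≤ D.n k + D.c ε := by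
  rw [U, Finset.filter_union]
  exact (Finset.card_union_le _ _).trans
    (add_le_add (D.card_P_le k ε hε) (D.card_image_a_filter_le k ε))

theorem card_F_filter_le {ε : ℤ} (hε : ε = 1 ∨ ε = -1) :
    (D.F.filter fun v => parity v = ε).card ≤ D.n 0 + D.n 1 + 2 * D.c ε := by
  rw [F, Finset.filter_union]
  have := D.card_U_filter_le 0 hε
  have := D.card_U_filter_le 1 hε
  have := Finset.card_union_le ((D.U 0).filter fun v => parity v = ε)
    ((D.U 1).filter fun v => parity v = ε)
  omega

variable {D}

theorem Valid.card_image_filter_le {S : Finset ι} {g : ι → Vert m} (h : D.Valid S g) (ε : ℤ) :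
    ((S.image g).filter fun v => parity v = -ε).card ≤ (S.filter fun j => D.par j = ε).card := by
  rw [Finset.filter_image]
  refine Finset.card_image_le.trans (Finset.card_le_card ?_)
  intro j hj
  rw [Finset.mem_filter] at hj ⊢
  refine ⟨hj.1, ?_⟩
  have := h.parity_eq j hj.1
  rw [hj.2] at this
  exact (neg_injective this).symm

/-- A set of vertices of one parity that is larger than the number of vertices in use contains an
unused one. -/
theorem Valid.exists_notMem {S : Finset ι} {g : ι → Vert m} (h : D.Valid S g) {ε : ℤ}
    (hε : ε = 1 ∨ ε = -1) {T : Finset (Vert m)} (hT : ∀ v ∈ T, parity v = -ε)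
    (hcard : D.n 0 + D.n 1 + 2 * D.c (-ε) + (S.filter fun j => D.par j = ε).card < T.card) :
    ∃ x ∈ T, x ∉ D.F ∧ x ∉ S.image g := by
  by_contra! hcon
  have hsub : T ⊆ (D.F.filter fun v => parity v = -ε) ∪
      ((S.image g).filter fun v => parity v = -ε) := by
    intro x hx
    rw [← Finset.filter_union, Finset.mem_filter, Finset.mem_union]
    refine ⟨?_, hT x hx⟩
    by_cases hF : x ∈ D.F
    · exact Or.inl hF
    · exact Or.inr (hcon x hx hF)
  have h1 := (Finset.card_le_card hsub).trans (Finset.card_union_le _ _)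
  have h2 := h.card_image_filter_le ε
  have h3 := D.card_F_filter_le (ε := -ε) (by rcases hε with rfl | rfl <;> simp)
  omega

theorem valid_empty (g : ι → Vert m) : D.Valid ∅ g := ⟨by simp, by simp, by simp⟩

theorem Valid.mono {S T : Finset ι} {g : ι → Vert m} (h : D.Valid S g) (hT : T ⊆ S) :
    D.Valid T g :=
  ⟨fun j hj => h.notMem j (hT hj), fun j hj => h.parity_eq j (hT hj),
    h.injOn.mono (Finset.coe_subset.2 hT)⟩

theorem card_filter_lt_of_notMem {S : Finset ι} {j : ι} (hj : j ∉ S) :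
    (S.filter fun l => D.par l = D.par j).card < D.c (D.par j) := by
  refine Finset.card_lt_card ((Finset.ssubset_iff_of_subset
    (Finset.filter_subset_filter _ (Finset.subset_univ S))).2 ⟨j, by simp, by simp [hj]⟩)

/-- A partial choice can be extended by a new vertex for any further crossing pair, even if two
more vertices are excluded. -/
theorem Valid.exists_new {S : Finset ι} {g : ι → Vert m} (h : D.Valid S g) {j : ι} (hj : j ∉ S)
    (y z : Vert m) :
    ∃ x, x ∉ D.F ∧ x ∉ S.image g ∧ parity x = -D.par j ∧ x ≠ y ∧ x ≠ z := by
  have hε := D.par_eq j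
  have hε' : -D.par j = 1 ∨ -D.par j = -1 := by rcases hε with h | h <;> simp [h]
  have h1 := two_mul_lt_card_parity D.le_dim hε'
  have h2 := card_filter_lt_of_notMem (D := D) hj
  have h3 := D.c_add_c_neg hε
  have h4 := D.card_le 0
  have h5 := D.card_le 1
  have h6 := Finset.le_card_sdiff ({y, z} : Finset (Vert m))
    (Finset.univ.filter fun v : Vert m => parity v = -D.par j)
  have h7 : ({y, z} : Finset (Vert m)).card ≤ 2 := Finset.card_le_two
  obtain ⟨x, hxT, hxF, hxS⟩ := h.exists_notMem hε
    (T := (Finset.univ.filter fun v : Vert m => parity v = -D.par j) \ {y, z})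
    (fun v hv => (Finset.mem_filter.1 (Finset.mem_sdiff.1 hv).1).2) (by omega)
  simp only [Finset.mem_sdiff, Finset.mem_filter, Finset.mem_univ, true_and, Finset.mem_insert,
    Finset.mem_singleton, not_or] at hxT
  exact ⟨x, hxF, hxS, hxT.1, hxT.2.1, hxT.2.2⟩

variable [DecidableEq ι]

theorem Valid.update {S : Finset ι} {g : ι → Vert m} (h : D.Valid S g) {j : ι} (hj : j ∉ S)
    {x : Vert m} (hxF : x ∉ D.F) (hxS : x ∉ S.image g) (hx : parity x = -D.par j) :
    D.Valid (insert j S) (Function.update g j x) := by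
  have hne : ∀ l ∈ S, l ≠ j := fun l hl e => hj (e ▸ hl)
  refine ⟨?_, ?_, ?_⟩
  · intro l hl
    rcases Finset.mem_insert.1 hl with rfl | hl
    · simpa using hxF
    · simpa [hne l hl] using h.notMem l hl
  · intro l hl
    rcases Finset.mem_insert.1 hl with rfl | hl
    · simpa using hx
    · simpa [hne l hl] using h.parity_eq l hl
  · rw [Finset.coe_insert, Set.injOn_insert (by exact_mod_cast hj)]
    refine ⟨h.injOn.congr fun l hl => by simp [hne l hl], ?_⟩
    rintro ⟨l, hl, hlx⟩
    rw [Function.update_self, Function.update_of_ne (hne l hl)] at hlx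
    exact hxS (Finset.mem_image.2 ⟨l, hl, hlx⟩)

theorem Valid.exists_insert {S : Finset ι} {g : ι → Vert m} (h : D.Valid S g) {j : ι} (hj : j ∉ S)
    {x : Vert m} (hxF : x ∉ D.F) (hxS : x ∉ S.image g) (hx : parity x = -D.par j) :
    ∃ g', D.Valid (insert j S) g' ∧ Set.EqOn g' g S ∧ g' j = x :=
  ⟨_, h.update hj hxF hxS hx,
    fun l hl => Function.update_of_ne (fun e : l = j => hj (e ▸ hl)) _ _, Function.update_self ..⟩

theorem Valid.exists_univ {S : Finset ι} {g : ι → Vert m} (h : D.Valid S g) :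
    ∃ g', D.Valid Finset.univ g' ∧ Set.EqOn g' g S := by
  suffices H : ∀ T : Finset ι, ∃ g', D.Valid (T ∪ S) g' ∧ Set.EqOn g' g S by
    obtain ⟨g', h1, h2⟩ := H Finset.univ
    exact ⟨g', h1.mono Finset.subset_union_left, h2⟩
  intro T
  induction T using Finset.induction_on with
  | empty => exact ⟨g, by simpa using h, fun _ _ => rfl⟩
  | insert j T _ ih =>
    obtain ⟨g', h1, h2⟩ := ih
    rw [Finset.insert_union]
    by_cases hj : j ∈ T ∪ S
    · rw [Finset.insert_eq_of_mem hj]; exact ⟨g', h1, h2⟩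
    · obtain ⟨x, hxF, hxS, hx, -⟩ := h1.exists_new hj 0 0
      obtain ⟨g'', h3, h4, -⟩ := h1.exists_insert hj hxF hxS hx
      exact ⟨g'', h3, (h4.mono (by simp)).trans h2⟩

/-- One new vertex can be changed such that no neighbourhood of a vertex of parity `par j` is
used up in a half. -/
theorem Valid.exists_update {g : ι → Vert m} (h : D.Valid Finset.univ g) (j : ι) :
    ∃ g', D.Valid Finset.univ g' ∧ (∀ l, l ≠ j → g' l = g l) ∧
      (∀ k v, parity v = D.par j → ¬ nbrs v ⊆ D.X k g') ∧
      ∀ k v, parity v = -D.par j → nbrs v ⊆ D.X k g' → nbrs v ⊆ D.X k g := by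
  have hε := D.par_eq j
  have hε' : -D.par j = 1 ∨ -D.par j = -1 := by rcases hε with h | h <;> simp [h]
  have hS : D.Valid (Finset.univ.erase j) g := h.mono (Finset.subset_univ _)
  have hj := Finset.notMem_erase j Finset.univ
  set S := Finset.univ.erase j with hSdef
  let Y : ZMod 2 → Finset (Vert m) := fun k =>
    ((D.U k).filter fun v => parity v = -D.par j) ∪
      ((S.image g).filter fun v => parity v = -D.par j)
  have hY : ∀ k, (Y k).card < m := by
    intro k
    have h1 := D.card_U_filter_le k hε'
    have h2 := hS.card_image_filter_le (D.par j)
    have h3 := card_filter_lt_of_notMem (D := D) hj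
    have h4 := D.c_add_c_neg hε
    have h5 := D.card_le k
    have := Finset.card_union_le ((D.U k).filter fun v => parity v = -D.par j)
      ((S.image g).filter fun v => parity v = -D.par j)
    simp only [Y]
    omega
  choose x₀ hx₀ using fun k => exists_forall_ne_not_nbrs_subset
    (by have := D.le_dim; omega) (hY k)
  obtain ⟨x, hxF, hxS, hx, hx0, hx1⟩ := hS.exists_new hj (x₀ 0) (x₀ 1)
  obtain ⟨g', h1, h2, h3⟩ := hS.exists_insert hj hxF hxS hx
  rw [hSdef, Finset.insert_erase (Finset.mem_univ j)] at h1
  have hg' : ∀ l, l ≠ j → g' l = g l := fun l hl => h2 (by simp [hSdef, hl])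
  refine ⟨g', h1, hg', ?_, ?_⟩
  · intro k v hv hsub
    refine hx₀ k x (by rcases zmod_two_eq k with rfl | rfl <;> assumption)
      v fun w hw => ?_
    have hwp := parity_of_mem_nbrs hw
    rw [hv] at hwp
    rw [Finset.mem_insert]
    rcases Finset.mem_union.1 (hsub hw) with hw' | hw'
    · exact Or.inr (Finset.mem_union_left _ (Finset.mem_filter.2 ⟨hw', hwp⟩))
    · obtain ⟨l, -, rfl⟩ := Finset.mem_image.1 hw'
      by_cases hl : l = j
      · left; rw [hl, h3]
      · right
        refine Finset.mem_union_right _ (Finset.mem_filter.2 ⟨?_, hwp⟩)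
        rw [hg' l hl]
        exact Finset.mem_image_of_mem _ (by simp [hSdef, hl])
  · intro k v hv hsub w hw
    have hwp := parity_of_mem_nbrs hw
    rw [hv, neg_neg] at hwp
    rcases Finset.mem_union.1 (hsub hw) with hw' | hw'
    · exact Finset.mem_union_left _ hw'
    · obtain ⟨l, -, rfl⟩ := Finset.mem_image.1 hw'
      by_cases hl : l = j
      · rw [hl, h3, hx] at hwp
        rcases hε with h | h <;> rw [h] at hwp <;> norm_num at hwp
      · rw [hg' l hl]
        exact Finset.mem_union_right _ (Finset.mem_image_of_mem _ (Finset.mem_univ _))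

/-- Every partial choice extends to a full one. If a crossing pair of parity `ε` is left to the
extension, then no vertex of parity `ε` has all its neighbours used in a half. -/
theorem Valid.exists_extension {S : Finset ι} {g : ι → Vert m} (h : D.Valid S g) :
    ∃ g', D.Valid Finset.univ g' ∧ Set.EqOn g' g S ∧
      ∀ ε, (∃ j ∉ S, D.par j = ε) → ∀ k v, parity v = ε → ¬ nbrs v ⊆ D.X k g' := by
  have key : ∀ (ε : ℤ) (g₁ : ι → Vert m), D.Valid Finset.univ g₁ → Set.EqOn g₁ g S →
      ∃ g', D.Valid Finset.univ g' ∧ Set.EqOn g' g S ∧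
        ((∃ j ∉ S, D.par j = ε) → ∀ k v, parity v = ε → ¬ nbrs v ⊆ D.X k g') ∧
        ∀ k v, parity v = -ε → nbrs v ⊆ D.X k g' → nbrs v ⊆ D.X k g₁ := by
    intro ε g₁ h1 h2
    by_cases hex : ∃ j ∉ S, D.par j = ε
    · obtain ⟨j, hj, rfl⟩ := hex
      obtain ⟨g', h3, h4, h5, h6⟩ := h1.exists_update j
      refine ⟨g', h3, fun l hl => ?_, fun _ => h5, h6⟩
      rw [h4 l fun e => hj (e ▸ hl), h2 hl]
    · exact ⟨g₁, h1, h2, fun h => absurd h hex, fun _ _ _ h => h⟩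
  obtain ⟨g₀, h1, h2⟩ := h.exists_univ
  obtain ⟨g₁, h3, h4, h5, -⟩ := key 1 g₀ h1 h2
  obtain ⟨g₂, h6, h7, h8, h9⟩ := key (-1) g₁ h3 h4
  refine ⟨g₂, h6, h7, ?_⟩
  rintro ε ⟨j, hj, rfl⟩ k v hv hsub
  rcases D.par_eq j with hp | hp
  · exact h5 ⟨j, hj, hp⟩ k v (hv.trans hp) (h9 k v (by rw [hv, hp]; rfl) hsub)
  · exact h8 ⟨j, hj, hp⟩ k v (hv.trans hp) hsub

/-- If few vertices are in use, then a partial choice can be extended by an edge. -/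
theorem Valid.exists_edge {S : Finset ι} {g : ι → Vert m} (h : D.Valid S g) (k : ZMod 2) {j : ι}
    (hj : j ∉ S) {ε : ℤ} (hjε : D.par j = ε)
    (hcard : D.n 0 + D.n 1 + 2 * D.c (-ε) + (S.filter fun j => D.par j = ε).card < m) :
    ∃ g', D.Valid (insert j S) g' ∧ Set.EqOn g' g S ∧ g' j ∈ nbrs (D.a k j) := by
  subst hjε
  have hpar : ∀ v ∈ nbrs (D.a k j), parity v = -D.par j := fun v hv => by
    rw [parity_of_mem_nbrs hv, D.parity_a]
  obtain ⟨x, hxT, hxF, hxS⟩ := h.exists_notMem (D.par_eq j) (T := nbrs (D.a k j)) hpar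
    (by rwa [card_nbrs])
  obtain ⟨g', h1, h2, h3⟩ := h.exists_insert hj hxF hxS (hpar x hxT)
  exact ⟨g', h1, h2, h3 ▸ hxT⟩

/-- As two vertices have almost disjoint neighbourhoods, one of any two crossing pairs of the same
parity can get an edge, even if the number of used vertices comes close to `2 * m`. -/
theorem Valid.exists_edge_of_pair {S : Finset ι} {g : ι → Vert m} (h : D.Valid S g) (k : ZMod 2)
    {j j' : ι} (hj : j ∉ S) (hj' : j' ∉ S) (hne : j ≠ j') {ε : ℤ} (hjε : D.par j = ε)
    (hjε' : D.par j' = ε)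
    (hcard : D.n 0 + D.n 1 + 2 * D.c (-ε) + (S.filter fun j => D.par j = ε).card + 2 < 2 * m) :
    ∃ l, (l = j ∨ l = j') ∧
      ∃ g', D.Valid (insert l S) g' ∧ Set.EqOn g' g S ∧ g' l ∈ nbrs (D.a k l) := by
  have hpar : ∀ l, D.par l = ε → ∀ v ∈ nbrs (D.a k l), parity v = -ε := fun l hl v hv => by
    rw [parity_of_mem_nbrs hv, D.parity_a, hl]
  have h1 := card_union_nbrs_ge ((D.a_injective k).ne hne)
  obtain ⟨x, hxT, hxF, hxS⟩ := h.exists_notMem (hjε ▸ D.par_eq j)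
    (T := nbrs (D.a k j) ∪ nbrs (D.a k j'))
    (fun v hv => (Finset.mem_union.1 hv).elim (hpar j hjε v) (hpar j' hjε' v)) (by omega)
  rcases Finset.mem_union.1 hxT with hx | hx
  · obtain ⟨g', h1, h2, h3⟩ := h.exists_insert hj hxF hxS (hjε ▸ hpar j hjε x hx)
    exact ⟨j, Or.inl rfl, g', h1, h2, h3 ▸ hx⟩
  · obtain ⟨g', h1, h2, h3⟩ := h.exists_insert hj' hxF hxS (hjε' ▸ hpar j' hjε' x hx)
    exact ⟨j', Or.inr rfl, g', h1, h2, h3 ▸ hx⟩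

end CrossingData

namespace CrossingData

/-! ### Counting edges of partial choices -/

variable {m : ℕ} {ι : Type} [Fintype ι] (D : CrossingData m ι)

/-- The number of crossing pairs in `S` whose ends have parity `ε`. -/
def count (S : Finset ι) (ε : ℤ) : ℕ := (S.filter fun j => D.par j = ε).card

/-- The number of crossing pairs in `S` for which the choice `g` gives an edge-pair in the `k`-th
half. -/
def edges (k : ZMod 2) (S : Finset ι) (g : ι → Vert m) : ℕ :=
  (S.filter fun j => g j ∈ nbrs (D.a k j)).card

/-- The choice `g'` on `S'` extends the choice `g` on `S`. -/
structure Extends (S : Finset ι) (g : ι → Vert m) (S' : Finset ι) (g' : ι → Vert m) : Prop where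
  valid : D.Valid S' g'
  subset : S ⊆ S'
  eqOn : Set.EqOn g' g S

variable {D}

theorem Extends.trans {S S' S'' : Finset ι} {g g' g'' : ι → Vert m} (h : D.Extends S g S' g')
    (h' : D.Extends S' g' S'' g'') : D.Extends S g S'' g'' :=
  ⟨h'.valid, h.subset.trans h'.subset,
    (h'.eqOn.mono (Finset.coe_subset.2 h.subset)).trans h.eqOn⟩

theorem Extends.edges_le {S S' : Finset ι} {g g' : ι → Vert m} (h : D.Extends S g S' g')
    (k : ZMod 2) : D.edges k S g ≤ D.edges k S' g' := by
  refine Finset.card_le_card fun j hj => ?_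
  rw [Finset.mem_filter] at hj ⊢
  refine ⟨h.subset hj.1, ?_⟩
  rw [h.eqOn hj.1]
  exact hj.2

theorem Extends.image_subset {S S' : Finset ι} {g g' : ι → Vert m} (h : D.Extends S g S' g') :
    S.image g ⊆ S'.image g' := by
  intro x hx
  obtain ⟨j, hj, rfl⟩ := Finset.mem_image.1 hx
  exact Finset.mem_image.2 ⟨j, h.subset hj, h.eqOn hj⟩

@[simp]
theorem count_empty (ε : ℤ) : D.count ∅ ε = 0 := by simp [count]

theorem count_le_c (S : Finset ι) (ε : ℤ) : D.count S ε ≤ D.c ε :=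
  Finset.card_le_card (Finset.filter_subset_filter _ (Finset.subset_univ S))

theorem par_ne_neg {j : ι} {ε : ℤ} (h : D.par j = ε) : D.par j ≠ -ε := by
  rw [← h, ← D.parity_a 0 j]; exact parity_ne_neg _

theorem mem_of_c_le_count {S : Finset ι} {ε : ℤ} (h : D.c ε ≤ D.count S ε) {j : ι}
    (hj : D.par j = ε) : j ∈ S := by
  have := Finset.eq_of_subset_of_card_le
    (Finset.filter_subset_filter (fun j => D.par j = ε) (Finset.subset_univ S)) h
  have hmem : j ∈ Finset.univ.filter fun j => D.par j = ε := by simp [hj]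
  rw [← this] at hmem
  exact (Finset.mem_filter.1 hmem).1

/-- If the choice is already made for all crossing pairs of parity `ε`, then the possible
neighbourhoods of vertices of parity `ε` inside the used vertices are determined. -/
theorem Extends.nbrs_subset {S : Finset ι} {g g' : ι → Vert m}
    (h : D.Extends S g Finset.univ g') {ε : ℤ} (hc : D.c ε ≤ D.count S ε) {k : ZMod 2}
    {v : Vert m} (hv : parity v = ε) (hsub : nbrs v ⊆ D.X k g') :
    nbrs v ⊆ ((D.U k).filter fun v => parity v = -ε) ∪
      (S.filter fun j => D.par j = ε).image g := by
  intro w hw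
  have hwp := parity_of_mem_nbrs hw
  rw [hv] at hwp
  rcases Finset.mem_union.1 (hsub hw) with hw' | hw'
  · exact Finset.mem_union_left _ (Finset.mem_filter.2 ⟨hw', hwp⟩)
  · obtain ⟨j, -, rfl⟩ := Finset.mem_image.1 hw'
    have hj : D.par j = ε := by
      rw [h.valid.parity_eq j (Finset.mem_univ j)] at hwp
      exact neg_injective hwp
    have hjS := mem_of_c_le_count hc hj
    exact Finset.mem_union_right _
      (Finset.mem_image.2 ⟨j, Finset.mem_filter.2 ⟨hjS, hj⟩, (h.eqOn hjS).symm⟩)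

/-- The vertices of parity `ε` whose neighbours are used by the given pairs of the `k`-th half
are in use themselves or by the partial choice. -/
def Covered (D : CrossingData m ι) (ε : ℤ) (k : ZMod 2) (S : Finset ι) (g : ι → Vert m) : Prop :=
  ∀ v, parity v = ε → nbrs v ⊆ D.U k → v ∈ D.U k ∨ v ∈ S.image g

theorem Covered.mono {ε : ℤ} {k : ZMod 2} {S S' : Finset ι} {g g' : ι → Vert m}
    (h : D.Covered ε k S g) (hE : D.Extends S g S' g') : D.Covered ε k S' g' :=
  fun v hv hs => (h v hv hs).imp_right fun hx => hE.image_subset hx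

variable [DecidableEq ι]

theorem Extends.edges_succ_le {S : Finset ι} {g g' : ι → Vert m} {j : ι}
    (h : D.Extends S g (insert j S) g') (hj : j ∉ S) {k : ZMod 2}
    (he : g' j ∈ nbrs (D.a k j)) : D.edges k S g + 1 ≤ D.edges k (insert j S) g' := by
  have : D.edges k S g ≤ D.edges k S g' := by
    refine Finset.card_le_card fun l hl => ?_
    rw [Finset.mem_filter] at hl ⊢
    rw [h.eqOn hl.1]
    exact hl
  rw [edges, edges, Finset.filter_insert, if_pos he,
    Finset.card_insert_of_notMem (by simp [hj])]
  exact Nat.succ_le_succ this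

theorem count_insert_self {S : Finset ι} {j : ι} (hj : j ∉ S) {ε : ℤ} (h : D.par j = ε) :
    D.count (insert j S) ε = D.count S ε + 1 := by
  rw [count, count, Finset.filter_insert, if_pos h, Finset.card_insert_of_notMem (by simp [hj])]

theorem count_insert_neg (S : Finset ι) {j : ι} {ε : ℤ} (h : D.par j = ε) :
    D.count (insert j S) (-ε) = D.count S (-ε) := by
  rw [count, count, Finset.filter_insert, if_neg (par_ne_neg h)]

theorem exists_notMem_par {S : Finset ι} {ε : ℤ} (h : D.count S ε < D.c ε) :
    ∃ j ∉ S, D.par j = ε := by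
  by_contra! hcon
  refine absurd (Finset.card_le_card fun j hj => ?_) (not_le.2 h)
  simp only [Finset.mem_filter, Finset.mem_univ, true_and] at hj ⊢
  exact ⟨by_contra fun hS => hcon j hS hj, hj⟩

theorem Valid.exists_extends_insert {S : Finset ι} {g : ι → Vert m} (h : D.Valid S g) {j : ι}
    (hj : j ∉ S) {k : ZMod 2} {x : Vert m} (hxF : x ∉ D.F) (hxS : x ∉ S.image g)
    (hx : x ∈ nbrs (D.a k j)) :
    ∃ g', D.Extends S g (insert j S) g' ∧ g' j = x ∧
      D.edges k S g + 1 ≤ D.edges k (insert j S) g' := by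
  obtain ⟨g', h1, h2, h3⟩ := h.exists_insert hj hxF hxS
    (by rw [parity_of_mem_nbrs hx, D.parity_a])
  have hE : D.Extends S g (insert j S) g' := ⟨h1, Finset.subset_insert _ _, h2⟩
  exact ⟨g', hE, h3, hE.edges_succ_le hj (h3 ▸ hx)⟩

/-- If at least two crossing pairs of parity `ε` are untreated, then one of them can get an
edge. -/
theorem Valid.exists_extends_edge {S : Finset ι} {g : ι → Vert m} (h : D.Valid S g) (k : ZMod 2)
    {ε : ℤ} (hc : D.count S ε + 1 < D.c ε)
    (hcard : D.n 0 + D.n 1 + 2 * D.c (-ε) + D.count S ε + 2 < 2 * m) :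
    ∃ S' g', D.Extends S g S' g' ∧ D.count S' ε = D.count S ε + 1 ∧
      D.count S' (-ε) = D.count S (-ε) ∧ D.edges k S g + 1 ≤ D.edges k S' g' := by
  obtain ⟨j, hj, hjε⟩ := exists_notMem_par (D := D) (S := S) (ε := ε) (by omega)
  obtain ⟨j', hj', hjε'⟩ := exists_notMem_par (D := D) (S := insert j S) (ε := ε)
    (by rw [count_insert_self hj hjε]; omega)
  rw [Finset.mem_insert, not_or] at hj'
  obtain ⟨l, hl, g', h1, h2, h3⟩ := h.exists_edge_of_pair k hj hj'.2 (Ne.symm hj'.1) hjε hjε' hcard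
  have hlS : l ∉ S := by rcases hl with rfl | rfl; exacts [hj, hj'.2]
  have hlε : D.par l = ε := by rcases hl with rfl | rfl <;> assumption
  have hE : D.Extends S g (insert l S) g' := ⟨h1, Finset.subset_insert _ _, h2⟩
  exact ⟨_, g', hE, count_insert_self hlS hlε, count_insert_neg S hlε, hE.edges_succ_le hlS h3⟩

/-- The condition that the `k`-th half gets at least `t` new edge-pairs and that every vertex of
this half with all its neighbours in use is itself in use. -/
def Good (D : CrossingData m ι) (t : ℕ) (g : ι → Vert m) (k : ZMod 2) : Prop :=
  t ≤ D.edges k Finset.univ g ∧ ∀ v, nbrs v ⊆ D.X k g → v ∈ D.X k g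

theorem Valid.exists_extends_univ {S : Finset ι} {g : ι → Vert m} (h : D.Valid S g) :
    ∃ g', D.Extends S g Finset.univ g' ∧
      ∀ ε, D.count S ε < D.c ε → ∀ k v, parity v = ε → ¬ nbrs v ⊆ D.X k g' := by
  obtain ⟨g', h1, h2, h3⟩ := h.exists_extension
  exact ⟨g', ⟨h1, Finset.subset_univ _, h2⟩, fun ε hε => h3 ε (exists_notMem_par hε)⟩

theorem parity_eq_or_of {ε : ℤ} (hε : ε = 1 ∨ ε = -1) (v : Vert m) :
    parity v = ε ∨ parity v = -ε := by
  rcases hε with rfl | rfl <;> rcases parity_eq_one_or v with h | h <;> simp [h]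

/-- If crossing pairs of both parities are left over, then a partial choice with enough edges
extends to a full choice as needed. -/
theorem Valid.exists_good {S : Finset ι} {g : ι → Vert m} (h : D.Valid S g) {ε : ℤ}
    (hε : ε = 1 ∨ ε = -1) (h1 : D.count S ε < D.c ε) (h2 : D.count S (-ε) < D.c (-ε)) :
    ∃ g', D.Valid Finset.univ g' ∧ ∀ t k, t ≤ D.edges k S g → D.Good t g' k := by
  obtain ⟨g', h3, h4⟩ := h.exists_extends_univ
  refine ⟨g', h3.valid, fun t k ht => ⟨ht.trans (h3.edges_le k), fun v hv => ?_⟩⟩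
  rcases parity_eq_or_of hε v with hp | hp
  · exact absurd hv (h4 ε h1 k v hp)
  · exact absurd hv (h4 (-ε) h2 k v hp)

/-! ### Crossing pairs of a single parity -/

theorem Valid.exists_good_of_covered {S : Finset ι} {g : ι → Vert m} (h : D.Valid S g) {ε : ℤ}
    (hε : ε = 1 ∨ ε = -1) (h1 : D.count S ε < D.c ε) (h2 : D.c (-ε) = 0) :
    ∃ g', D.Valid Finset.univ g' ∧
      ∀ t k, t ≤ D.edges k S g → D.Covered (-ε) k S g → D.Good t g' k := by
  obtain ⟨g', h3, h4⟩ := h.exists_extends_univ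
  refine ⟨g', h3.valid, fun t k ht hcov => ⟨ht.trans (h3.edges_le k), fun v hv => ?_⟩⟩
  rcases parity_eq_or_of hε v with hp | hp
  · exact absurd hv (h4 ε h1 k v hp)
  · have hsub := h3.nbrs_subset (ε := -ε) (by omega) hp hv
    rw [Finset.card_eq_zero.1 (Nat.le_zero.1 ((count_le_c S (-ε)).trans h2.le)),
      Finset.image_empty, Finset.union_empty] at hsub
    rcases hcov v hp (hsub.trans (Finset.filter_subset _ _)) with hU | hS
    · exact Finset.mem_union_left _ hU
    · obtain ⟨j, hj, rfl⟩ := Finset.mem_image.1 hS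
      exact Finset.mem_union_right _ (Finset.mem_image.2 ⟨j, Finset.mem_univ j, h3.eqOn hj⟩)

/-- If all crossing pairs have the same parity `ε`, then the given pairs alone may use up the
neighbourhood of an unused vertex. This vertex is taken as a new one. It is adjacent to the ends
of all crossing pairs, hence this yields an edge. -/
theorem Valid.exists_covered {S : Finset ι} {g : ι → Vert m} (h : D.Valid S g) {ε : ℤ}
    (hε : ε = 1 ∨ ε = -1) (h1 : D.count S ε < D.c ε) (h2 : D.c (-ε) = 0) {k : ZMod 2}
    (henc : ∀ v, parity v = -ε → nbrs v ⊆ D.U k → v ∈ D.U (k + 1) → v ∈ D.U k)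
    (hcard : D.n 0 + D.n 1 + D.count S ε < m) :
    ∃ S' g', D.Extends S g S' g' ∧ D.count S' ε ≤ D.count S ε + 1 ∧ 1 ≤ D.edges k S' g' ∧
      D.Covered (-ε) k S' g' := by
  obtain ⟨j, hj, hjε⟩ := exists_notMem_par h1
  by_cases hex : ∃ v, parity v = -ε ∧ nbrs v ⊆ D.U k ∧ v ∉ D.U k
  · obtain ⟨v, hv, hvU, hvk⟩ := hex
    -- By counting, the neighbourhood is a full parity class of `D.U k`, so `v` is unique.
    have key : ∀ w, parity w = -ε → nbrs w ⊆ D.U k →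
        nbrs w = (D.U k).filter fun v => parity v = ε := by
      intro w hw hwU
      refine Finset.eq_of_subset_of_card_le (fun x hx => Finset.mem_filter.2 ⟨hwU hx, ?_⟩) ?_
      · rw [parity_of_mem_nbrs hx, hw, neg_neg]
      · rw [card_nbrs]
        have := D.card_U_filter_le k hε
        have := D.c_add_c_neg hε
        have := D.card_le k
        omega
    have huniq : ∀ w, parity w = -ε → nbrs w ⊆ D.U k → w = v := by
      intro w hw hwU
      refine eq_of_subset_nbrs (Y := nbrs w) ?_ subset_rfl ?_
      · rw [card_nbrs]; have := D.le_dim; omega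
      · rw [key w hw hwU, key v hv hvU]
    have hadj : ∀ l, D.par l = ε → v ∈ nbrs (D.a k l) := by
      intro l hl
      rw [mem_nbrs_comm, key v hv hvU, Finset.mem_filter, D.parity_a]
      exact ⟨D.a_mem_U k l, hl⟩
    by_cases hvS : v ∈ S.image g
    · refine ⟨S, g, ⟨h, subset_rfl, fun _ _ => rfl⟩, by omega, ?_, fun w hw hwU => Or.inr ?_⟩
      · obtain ⟨l, hl, hlv⟩ := Finset.mem_image.1 hvS
        refine Finset.card_pos.2 ⟨l, Finset.mem_filter.2 ⟨hl, hlv ▸ hadj l ?_⟩⟩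
        have := h.parity_eq l hl
        rw [hlv, hv] at this
        exact (neg_injective this).symm
      · rwa [huniq w hw hwU]
    · have hvF : v ∉ D.F := by
        rw [D.mem_F_iff k, not_or]
        exact ⟨hvk, fun h => hvk (henc v hv hvU h)⟩
      obtain ⟨g', hE, h3, h4⟩ := h.exists_extends_insert hj hvF hvS (hadj j hjε)
      refine ⟨_, g', hE, (count_insert_self hj hjε).le, by omega, fun w hw hwU => Or.inr ?_⟩
      rw [huniq w hw hwU, ← h3]
      exact Finset.mem_image_of_mem _ (Finset.mem_insert_self _ _)
  · push Not at hex
    obtain ⟨g', h3, h4, h5⟩ := h.exists_edge k hj hjε (by rw [h2]; simpa [count] using hcard)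
    have hE : D.Extends S g (insert j S) g' := ⟨h3, Finset.subset_insert _ _, h4⟩
    refine ⟨_, g', hE, (count_insert_self hj hjε).le, ?_, fun w hw hwU => Or.inl (hex w hw hwU)⟩
    have := hE.edges_succ_le hj h5
    omega

end CrossingData

namespace CrossingData

variable {m : ℕ} {ι : Type} [Fintype ι] {D : CrossingData m ι}

/-! ### Choices for `m` pairs -/

theorem exists_c_neg_le (D : CrossingData m ι) : ∃ ε : ℤ, (ε = 1 ∨ ε = -1) ∧ D.c (-ε) ≤ D.c ε := by
  rcases le_total (D.c (-1)) (D.c 1) with h | h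
  · exact ⟨1, Or.inl rfl, h⟩
  · exact ⟨-1, Or.inr rfl, by simpa using h⟩

variable [DecidableEq ι]

/-- Two pairs of one parity and a single pair of the other parity, with only two vertices left in
a half: both edges have to be chosen for the first two pairs. They are chosen such that the new
vertices do not complete a neighbourhood. -/
theorem exists_good_two_of_three (k : ZMod 2) (hl : D.n (k + 1) = 0)
    (hk : D.n k + 3 = m) {ε : ℤ} (hε : ε = 1 ∨ ε = -1) (h2 : D.c ε = 2) (h1 : D.c (-ε) = 1) :
    ∃ g, D.Valid Finset.univ g ∧ D.Good 2 g k := by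
  have hm := D.le_dim
  have hε' : -ε = 1 ∨ -ε = -1 := by rcases hε with rfl | rfl <;> simp
  have hn := D.n_add_n k
  set Y := (D.U k).filter fun v => parity v = -ε with hYdef
  have hYcard : Y.card + 2 ≤ m := by
    have := D.card_U_filter_le k hε'
    rw [← hYdef] at this
    omega
  have hYF : Y ⊆ D.F := (Finset.filter_subset _ _).trans (D.U_subset_F k)
  -- The two vertices that together with `Y` form a neighbourhood, if they exist.
  obtain ⟨E, hE, hE'⟩ : ∃ E : Finset (Vert m), E.card ≤ 2 ∧
      ∀ x ∉ E, x ∉ Y → ∀ v, Y ⊆ nbrs v → m ≤ Y.card + 2 → x ∉ nbrs v := by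
    by_cases hex : ∃ v, Y ⊆ nbrs v ∧ m ≤ Y.card + 2
    · obtain ⟨v, hv, hc⟩ := hex
      refine ⟨nbrs v \ Y, ?_, fun x hx hxY w hw _ hxw => hx ?_⟩
      · rw [Finset.card_sdiff_of_subset hv, card_nbrs]; omega
      · rw [eq_of_subset_nbrs (by omega) hv hw]
        exact Finset.mem_sdiff.2 ⟨hxw, hxY⟩
    · exact ⟨∅, by simp, fun x _ _ v hv hc => absurd ⟨v, hv, hc⟩ hex⟩
  obtain ⟨j₁, hj₁, hp₁⟩ := exists_notMem_par (D := D) (S := ∅) (ε := ε) (by simp [h2])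
  obtain ⟨j₂, hj₂, hp₂⟩ := exists_notMem_par (D := D) (S := insert j₁ ∅) (ε := ε)
    (by rw [count_insert_self hj₁ hp₁]; simp [h2])
  have hne : j₁ ≠ j₂ := fun h => hj₂ (by simp [h])
  have h0 : D.Valid ∅ fun _ => 0 := valid_empty _
  have hfree : ∀ T : Finset (Vert m), (∀ v ∈ T, parity v = -ε) → m ≤ T.card →
      ∃ x ∈ T, x ∉ D.F := by
    intro T hT hc
    obtain ⟨x, hx, hxF, -⟩ := h0.exists_notMem hε hT
      (by rw [Finset.filter_empty, Finset.card_empty]; omega)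
    exact ⟨x, hx, hxF⟩
  have hpar : ∀ l, D.par l = ε → ∀ v ∈ nbrs (D.a k l), parity v = -ε := fun l hl v hv => by
    rw [parity_of_mem_nbrs hv, D.parity_a, hl]
  have hcard := card_union_nbrs_ge ((D.a_injective k).ne hne)
  have hfree₂ : ∀ E : Finset (Vert m), E.card ≤ 2 → ∃ x, x ∉ E ∧ x ∉ D.F ∧
      (x ∈ nbrs (D.a k j₁) ∨ x ∈ nbrs (D.a k j₂)) := by
    intro E hE
    have := Finset.le_card_sdiff E (nbrs (D.a k j₁) ∪ nbrs (D.a k j₂))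
    obtain ⟨x, hx, hxF⟩ := hfree ((nbrs (D.a k j₁) ∪ nbrs (D.a k j₂)) \ E)
      (fun v hv => (Finset.mem_union.1 (Finset.mem_sdiff.1 hv).1).elim
        (hpar j₁ hp₁ v) (hpar j₂ hp₂ v)) (by omega)
    rw [Finset.mem_sdiff, Finset.mem_union] at hx
    exact ⟨x, hx.2, hxF, hx.1⟩
  obtain ⟨x, hxE, hxF, hx⟩ := hfree₂ E hE
  -- A system of distinct representatives that uses `x`.
  obtain ⟨y, l, l', hll', hlp, hlp', hyx, hyF, hxl, hyl⟩ : ∃ y l l', l ≠ l' ∧ D.par l = ε ∧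
      D.par l' = ε ∧ y ≠ x ∧ y ∉ D.F ∧ x ∈ nbrs (D.a k l) ∧ y ∈ nbrs (D.a k l') := by
    have key : ∀ l l', l ≠ l' → D.par l = ε → D.par l' = ε → x ∈ nbrs (D.a k l) →
        (∀ y, y ∈ nbrs (D.a k j₁) ∨ y ∈ nbrs (D.a k j₂) →
          y ∈ nbrs (D.a k l) ∨ y ∈ nbrs (D.a k l')) →
        ∃ y l l', l ≠ l' ∧ D.par l = ε ∧
          D.par l' = ε ∧ y ≠ x ∧ y ∉ D.F ∧ x ∈ nbrs (D.a k l) ∧ y ∈ nbrs (D.a k l') := by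
      intro l l' hll' hlp hlp' hxl hcov
      obtain ⟨z, hzl, hzF⟩ := hfree (nbrs (D.a k l')) (hpar l' hlp') (card_nbrs _).ge
      by_cases hzx : z = x
      · obtain ⟨y, hyx, hyF, hy⟩ := hfree₂ {x} (by simp)
        have hyx : y ≠ x := by simpa using hyx
        rcases hcov y hy with h | h
        · exact ⟨y, l', l, hll'.symm, hlp', hlp, hyx, hyF, hzx ▸ hzl, h⟩
        · exact ⟨y, l, l', hll', hlp, hlp', hyx, hyF, hxl, h⟩
      · exact ⟨z, l, l', hll', hlp, hlp', hzx, hzF, hxl, hzl⟩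
    rcases hx with hx | hx
    · exact key j₁ j₂ hne hp₁ hp₂ hx fun _ h => h
    · exact key j₂ j₁ hne.symm hp₂ hp₁ hx fun _ h => h.symm
  obtain ⟨g₁, hE₁, hg₁, he₁⟩ := h0.exists_extends_insert (j := l) (by simp) hxF (by simp) hxl
  have hl' : l' ∉ insert l (∅ : Finset ι) := by simp [hll'.symm]
  obtain ⟨g₂, hE₂, hg₂, he₂⟩ := hE₁.valid.exists_extends_insert hl' hyF
    (by simpa [hg₁] using hyx) hyl
  obtain ⟨g, hg, hnb⟩ := hE₂.valid.exists_extends_univ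
  have hcount : D.count (insert l' (insert l ∅)) ε = 2 := by
    rw [count_insert_self hl' hlp', count_insert_self (by simp) hlp, count_empty]
  refine ⟨g, hg.valid, ?_, fun v hv => ?_⟩
  · have := hg.edges_le k
    omega
  rcases parity_eq_or_of hε v with hp | hp
  · have hsub := hg.nbrs_subset (by omega) hp hv
    have hc : ((insert l' (insert l (∅ : Finset ι))).filter fun j => D.par j = ε).image g₂ ⊆
        {x, y} := by
      intro w hw
      obtain ⟨j, hj, rfl⟩ := Finset.mem_image.1 hw
      rw [Finset.mem_filter, Finset.mem_insert, Finset.mem_insert] at hj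
      rcases hj.1 with rfl | rfl | h
      · simp [hg₂]
      · rw [hE₂.eqOn (by simp), hg₁]; simp
      · simp at h
    replace hsub : nbrs v ⊆ Y ∪ {x, y} := hsub.trans (Finset.union_subset_union_right hc)
    have hxy : ({x, y} : Finset (Vert m)).card = 2 := Finset.card_pair hyx.symm
    have hYv := subset_nbrs_of_nbrs_subset_union (by omega) hsub
    have hxv := subset_nbrs_of_nbrs_subset_union (Y := {x, y}) (D := Y) (by omega)
      (by rwa [Finset.union_comm])
    have hm' := (Finset.card_le_card hsub).trans (Finset.card_union_le _ _)
    rw [card_nbrs, hxy] at hm'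
    exact absurd (hxv (by simp)) (hE' x hxE (fun h => hxF (hYF h)) v hYv hm')
  · refine absurd hv (hnb (-ε) ?_ k v hp)
    rw [count_insert_neg _ hlp', count_insert_neg _ hlp, count_empty, h1]
    exact one_pos

/-- If there are `m` pairs, then the halves with `m` pairs in the completion can get two new
edge-pairs each and encompass no vertex. Such a half exists only if the other half contains no
pair. The edges are distributed such that a crossing pair of either parity is left over, whenever
this is possible. -/
theorem exists_good_two (hsum : D.n 0 + D.n 1 + Fintype.card ι = m)
    (hle : ∀ k, D.n k + 3 ≤ m) (hsix : D.n 0 = 0 → D.n 1 = 0 → 6 ≤ m)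
    (hP : ∀ k, D.n k = 0 → D.P k = ∅) :
    ∃ g, D.Valid Finset.univ g ∧ ∀ k, D.n k + Fintype.card ι = m → D.Good 2 g k := by
  have hm := D.le_dim
  have h0 : D.Valid ∅ fun _ => 0 := valid_empty _
  have hn := D.n_add_n
  obtain ⟨ε, hε, hc⟩ := D.exists_c_neg_le
  have hcs := D.c_add_c_neg hε
  have hnn := neg_neg ε
  by_cases ht : ∃ k, D.n k + Fintype.card ι = m
  swap
  · push Not at ht
    obtain ⟨g, hg, -⟩ := h0.exists_univ
    exact ⟨g, hg, fun k hk => absurd hk (ht k)⟩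
  obtain ⟨k, hk⟩ := ht
  have hk1 := hn k
  have hl : D.n (k + 1) = 0 := by omega
  have hle' := hle k
  have henc : D.c (-ε) = 0 → ∀ k, D.n k + Fintype.card ι = m →
      ∀ v, parity v = -ε → nbrs v ⊆ D.U k → v ∈ D.U (k + 1) → v ∈ D.U k := by
    intro h0 k hk v hv _ hvU
    have := hn k
    rw [U, hP (k + 1) (by omega), Finset.empty_union] at hvU
    obtain ⟨j, -, rfl⟩ := Finset.mem_image.1 hvU
    rw [D.parity_a] at hv
    exact absurd (mem_of_c_le_count (D := D) (S := ∅) (by simp [h0]) hv) (by simp)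
  -- Either all pairs cross, and both halves get `m` pairs, or only the `k`-th half does.
  by_cases hk0 : D.n k = 0
  · have hall := zmod_two_eq_or_eq_add_one k
    have hlk : D.n (k + 1) + Fintype.card ι = m := by omega
    have hm6 : 6 ≤ m := by
      rcases zmod_two_eq k with rfl | rfl
      · exact hsix hk0 hl
      · exact hsix hl hk0
    suffices H : ∃ g, D.Valid Finset.univ g ∧ D.Good 2 g k ∧ D.Good 2 g (k + 1) by
      obtain ⟨g, hg, h1, h2⟩ := H
      refine ⟨g, hg, fun k' _ => ?_⟩
      rcases hall k' with rfl | rfl <;> assumption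
    rcases (by omega : D.c (-ε) = 0 ∨ D.c (-ε) = 1 ∨ D.c (-ε) = 2 ∨ 3 ≤ D.c (-ε)) with
      hc0 | hc1 | hc2 | hc3
    -- The two edges from `exists_covered` may belong to the same crossing pair; with the two
    -- further ones, at most four crossing pairs are treated.
    · obtain ⟨S₁, g₁, e₁, n₁, d₁, v₁⟩ := h0.exists_covered hε (k := k)
        (by rw [count_empty]; omega) hc0 (henc hc0 k hk) (by rw [count_empty]; omega)
      rw [count_empty] at n₁
      obtain ⟨S₂, g₂, e₂, n₂, d₂, v₂⟩ := e₁.valid.exists_covered hε (k := k + 1)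
        (by omega) hc0 (henc hc0 _ hlk) (by omega)
      obtain ⟨S₃, g₃, e₃, n₃, -, d₃⟩ := e₂.valid.exists_extends_edge k (ε := ε)
        (by omega) (by omega)
      obtain ⟨S₄, g₄, e₄, n₄, -, d₄⟩ := e₃.valid.exists_extends_edge (k + 1) (ε := ε)
        (by omega) (by omega)
      obtain ⟨g, hg, hgood⟩ := e₄.valid.exists_good_of_covered hε (by omega) hc0
      have := e₂.edges_le k
      have := e₃.edges_le (k + 1)
      have := e₄.edges_le k
      exact ⟨g, hg, hgood 2 k (by omega) (v₁.mono (e₂.trans (e₃.trans e₄))),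
        hgood 2 _ (by omega) (v₂.mono (e₃.trans e₄))⟩
    all_goals
      obtain ⟨S₁, g₁, e₁, n₁, n₁', d₁⟩ := h0.exists_extends_edge k (ε := ε)
        (by rw [count_empty]; omega) (by rw [count_empty]; omega)
      rw [count_empty] at n₁ n₁'
      obtain ⟨S₂, g₂, e₂, n₂, n₂', d₂⟩ := e₁.valid.exists_extends_edge (k + 1) (ε := ε)
        (by omega) (by omega)
      have := e₂.edges_le k
    -- All four edges for pairs of parity `ε`.
    · obtain ⟨S₃, g₃, e₃, n₃, n₃', d₃⟩ := e₂.valid.exists_extends_edge k (ε := ε)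
        (by omega) (by omega)
      obtain ⟨S₄, g₄, e₄, n₄, n₄', d₄⟩ := e₃.valid.exists_extends_edge (k + 1) (ε := ε)
        (by omega) (by omega)
      obtain ⟨g, hg, hgood⟩ := e₄.valid.exists_good hε (by omega) (by omega)
      have := e₃.edges_le (k + 1)
      have := e₄.edges_le k
      exact ⟨g, hg, hgood 2 k (by omega), hgood 2 _ (by omega)⟩
    -- Three edges for pairs of parity `ε` and one for a pair of parity `-ε`.
    · obtain ⟨S₃, g₃, e₃, n₃, n₃', d₃⟩ := e₂.valid.exists_extends_edge k (ε := ε)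
        (by omega) (by omega)
      obtain ⟨S₄, g₄, e₄, n₄, n₄', d₄⟩ := e₃.valid.exists_extends_edge (k + 1) (ε := -ε)
        (by omega) (by rw [neg_neg]; omega)
      rw [neg_neg] at n₄'
      obtain ⟨g, hg, hgood⟩ := e₄.valid.exists_good hε (by omega) (by omega)
      have := e₃.edges_le (k + 1)
      have := e₄.edges_le k
      exact ⟨g, hg, hgood 2 k (by omega), hgood 2 _ (by omega)⟩
    -- Two edges for pairs of each parity.
    · obtain ⟨S₃, g₃, e₃, n₃, n₃', d₃⟩ := e₂.valid.exists_extends_edge k (ε := -ε)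
        (by omega) (by rw [neg_neg]; omega)
      rw [neg_neg] at n₃'
      obtain ⟨S₄, g₄, e₄, n₄, n₄', d₄⟩ := e₃.valid.exists_extends_edge (k + 1) (ε := -ε)
        (by omega) (by rw [neg_neg]; omega)
      rw [neg_neg] at n₄'
      obtain ⟨g, hg, hgood⟩ := e₄.valid.exists_good hε (by omega) (by omega)
      have := e₃.edges_le (k + 1)
      have := e₄.edges_le k
      exact ⟨g, hg, hgood 2 k (by omega), hgood 2 _ (by omega)⟩
  · suffices H : ∃ g, D.Valid Finset.univ g ∧ D.Good 2 g k by
      obtain ⟨g, hg, h1⟩ := H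
      refine ⟨g, hg, fun k' hk' => ?_⟩
      rcases zmod_two_eq_or_eq_add_one k k' with rfl | rfl
      · exact h1
      · omega
    by_cases hc0 : D.c (-ε) = 0
    · obtain ⟨S₁, g₁, e₁, n₁, d₁, v₁⟩ := h0.exists_covered hε (k := k)
        (by rw [count_empty]; omega) hc0 (henc hc0 k hk) (by rw [count_empty]; omega)
      rw [count_empty] at n₁
      obtain ⟨S₂, g₂, e₂, n₂, -, d₂⟩ := e₁.valid.exists_extends_edge k (ε := ε)
        (by omega) (by omega)
      obtain ⟨g, hg, hgood⟩ := e₂.valid.exists_good_of_covered hε (by omega) hc0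
      exact ⟨g, hg, hgood 2 k (by omega) (v₁.mono e₂)⟩
    by_cases hc21 : D.c ε = 2 ∧ D.c (-ε) = 1
    · exact exists_good_two_of_three k hl (by omega) hε hc21.1 hc21.2
    obtain ⟨S₁, g₁, e₁, n₁, n₁', d₁⟩ := h0.exists_extends_edge k (ε := ε)
      (by rw [count_empty]; omega) (by rw [count_empty]; omega)
    rw [count_empty] at n₁ n₁'
    by_cases hlt : D.c (-ε) < D.c ε
    · obtain ⟨S₂, g₂, e₂, n₂, n₂', d₂⟩ := e₁.valid.exists_extends_edge k (ε := ε)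
        (by omega) (by omega)
      obtain ⟨g, hg, hgood⟩ := e₂.valid.exists_good hε (by omega) (by omega)
      exact ⟨g, hg, hgood 2 k (by omega)⟩
    · obtain ⟨S₂, g₂, e₂, n₂, n₂', d₂⟩ := e₁.valid.exists_extends_edge k (ε := -ε)
        (by omega) (by rw [neg_neg]; omega)
      rw [neg_neg] at n₂'
      obtain ⟨g, hg, hgood⟩ := e₂.valid.exists_good hε (by omega) (by omega)
      exact ⟨g, hg, hgood 2 k (by omega)⟩

/-! ### Choices for `m + 1` pairs -/

/-- Two pairs of different parities, with a single vertex of each parity left in a half: the only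
available vertices for the edge might complete a neighbourhood, but then there are others. -/
theorem exists_good_one_of_two (k : ZMod 2) (hl : D.n (k + 1) = 1) (hk : D.n k + 2 = m)
    (hc : ∀ ε, ε = 1 ∨ ε = -1 → D.c ε = 1) {j : ι} {x : Vert m} (hx : x ∈ nbrs (D.a k j))
    (hxF : x ∉ D.F) :
    ∃ g, D.Valid Finset.univ g ∧ D.Good 1 g k := by
  have hm := D.le_dim
  obtain ⟨ε, hpar⟩ : ∃ ε, D.par j = ε := ⟨_, rfl⟩
  have hε : ε = 1 ∨ ε = -1 := hpar ▸ D.par_eq j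
  have hε' : -ε = 1 ∨ -ε = -1 := by rcases hε with rfl | rfl <;> simp
  have hc₁ := hc ε hε
  have hc₂ := hc (-ε) hε'
  set Y := (D.U k).filter fun v => parity v = -ε with hYdef
  have hYcard : Y.card + 1 ≤ m := by
    have := D.card_U_filter_le k hε'
    rw [← hYdef] at this
    omega
  obtain ⟨y, hyF, hy, hyY⟩ : ∃ y, y ∉ D.F ∧ y ∈ nbrs (D.a k j) ∧
      ∀ v, nbrs v ⊆ Y ∪ {y} → v ∈ D.U k := by
    have key : ∀ z v, nbrs v ⊆ Y ∪ {z} → Y ⊆ nbrs v ∧ z ∈ nbrs v ∧ 3 ≤ Y.card := by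
      intro z v hv
      have h := (Finset.card_le_card hv).trans (Finset.card_union_le _ _)
      rw [card_nbrs, Finset.card_singleton] at h
      refine ⟨subset_nbrs_of_nbrs_subset_union (by simpa using hYcard) hv, ?_, by omega⟩
      have := subset_nbrs_of_nbrs_subset_union (Y := {z}) (D := Y)
        (by simpa [add_comm] using hYcard) (by rwa [Finset.union_comm])
      exact this (Finset.mem_singleton_self z)
    by_cases hex : ∃ v, nbrs v ⊆ Y ∪ {x} ∧ v ∉ D.U k
    -- The new vertex is chosen outside the only neighbourhood that contains `Y`.
    · obtain ⟨v, hv, hvU⟩ := hex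
      have hne : D.a k j ≠ v := fun h => hvU (h ▸ D.a_mem_U k j)
      have h1 := card_nbrs_inter_le hne
      have h2 := Finset.card_sdiff_add_card_inter (nbrs (D.a k j)) (nbrs v)
      rw [card_nbrs] at h2
      obtain ⟨y, hy, hyU⟩ : ∃ y ∈ nbrs (D.a k j) \ nbrs v, y ∉ D.U (k + 1) := by
        by_contra! hcon
        have h3 : nbrs (D.a k j) \ nbrs v ⊆
            (D.U (k + 1)).filter fun v => parity v = -ε := by
          intro y hy
          refine Finset.mem_filter.2 ⟨hcon y hy, ?_⟩
          rw [parity_of_mem_nbrs (Finset.mem_sdiff.1 hy).1, D.parity_a, hpar]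
        have h4 := Finset.card_le_card h3
        have h5 := D.card_U_filter_le (k + 1) hε'
        omega
      rw [Finset.mem_sdiff] at hy
      refine ⟨y, ?_, hy.1, fun w hw => ?_⟩
      · rw [D.mem_F_iff k, not_or]
        refine ⟨fun h => hy.2 ((key x v hv).1 (Finset.mem_filter.2 ⟨h, ?_⟩)), hyU⟩
        rw [parity_of_mem_nbrs hy.1, D.parity_a, hpar]
      · obtain rfl := eq_of_subset_nbrs (key x v hv).2.2 (key x v hv).1 (key y w hw).1
        exact absurd (key y v hw).2.1 hy.2
    · push Not at hex
      exact ⟨x, hxF, hx, hex⟩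
  have h0 : D.Valid ∅ fun _ => 0 := valid_empty _
  obtain ⟨g₁, hE₁, hg₁, he₁⟩ := h0.exists_extends_insert (j := j) (by simp) hyF (by simp) hy
  obtain ⟨g, hg, hnb⟩ := hE₁.valid.exists_extends_univ
  refine ⟨g, hg.valid, ?_, fun v hv => ?_⟩
  · have := hg.edges_le k
    omega
  rcases parity_eq_or_of hε v with hp | hp
  · have hsub := hg.nbrs_subset (by rw [count_insert_self (by simp) hpar]; omega) hp hv
    refine Finset.mem_union_left _ (hyY v (hsub.trans (Finset.union_subset_union_right ?_)))
    intro w hw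
    obtain ⟨l, hl, rfl⟩ := Finset.mem_image.1 hw
    have : l = j := by simpa using (Finset.mem_filter.1 hl).1
    rw [this, hg₁]; simp
  · refine absurd hv (hnb (-ε) ?_ k v hp)
    rw [count_insert_neg _ hpar, count_empty, hc₂]
    exact one_pos

/-- If there are `m + 1` pairs, then the halves with `m` pairs in the completion can get a new
edge-pair each and encompass no vertex. Such a half exists only if the other half contains a
single pair. -/
theorem exists_good_one (hsum : D.n 0 + D.n 1 + Fintype.card ι = m + 1)
    (hge : ∀ k, 1 ≤ D.n k) (hle : ∀ k, D.n k + 2 ≤ m)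
    (henc : ∀ k v, nbrs v ⊆ D.U k → v ∈ D.U (k + 1) → v ∈ D.U k)
    (hbad : ∀ k, D.n (k + 1) = 1 → Fintype.card ι = 2 → ∀ j₀ j₁, D.par j₀ ≠ D.par j₁ →
      ∃ j, ∃ x ∈ nbrs (D.a k j), x ∉ D.F) :
    ∃ g, D.Valid Finset.univ g ∧ ∀ k, D.n k + Fintype.card ι = m → D.Good 1 g k := by
  have hm := D.le_dim
  have h0 : D.Valid ∅ fun _ => 0 := valid_empty _
  have hn := D.n_add_n
  obtain ⟨ε, hε, hc⟩ := D.exists_c_neg_le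
  have hcs := D.c_add_c_neg hε
  have hnn := neg_neg ε
  by_cases ht : ∃ k, D.n k + Fintype.card ι = m
  swap
  · push Not at ht
    obtain ⟨g, hg, -⟩ := h0.exists_univ
    exact ⟨g, hg, fun k hk => absurd hk (ht k)⟩
  obtain ⟨k, hk⟩ := ht
  have hk1 := hn k
  have hl : D.n (k + 1) = 1 := by omega
  have hle' := hle k
  have hge' := hge k
  -- Either both halves contain a single pair and get `m` pairs, or only the `k`-th half does.
  by_cases hk0 : D.n k = 1
  · have hlk : D.n (k + 1) + Fintype.card ι = m := by omega
    suffices H : ∃ g, D.Valid Finset.univ g ∧ D.Good 1 g k ∧ D.Good 1 g (k + 1) by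
      obtain ⟨g, hg, h1, h2⟩ := H
      refine ⟨g, hg, fun k' _ => ?_⟩
      rcases zmod_two_eq_or_eq_add_one k k' with
        rfl | rfl <;> assumption
    by_cases hc0 : D.c (-ε) = 0
    · obtain ⟨S₁, g₁, e₁, n₁, d₁, v₁⟩ := h0.exists_covered hε (k := k)
        (by rw [count_empty]; omega) hc0 (fun v _ => henc k v) (by rw [count_empty]; omega)
      rw [count_empty] at n₁
      obtain ⟨S₂, g₂, e₂, n₂, d₂, v₂⟩ := e₁.valid.exists_covered hε (k := k + 1)
        (by omega) hc0 (fun v _ => henc _ v) (by omega)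
      obtain ⟨g, hg, hgood⟩ := e₂.valid.exists_good_of_covered hε (by omega) hc0
      have := e₂.edges_le k
      exact ⟨g, hg, hgood 1 k (by omega) (v₁.mono e₂), hgood 1 _ (by omega) v₂⟩
    obtain ⟨S₁, g₁, e₁, n₁, n₁', d₁⟩ := h0.exists_extends_edge k (ε := ε)
      (by rw [count_empty]; omega) (by rw [count_empty]; omega)
    rw [count_empty] at n₁ n₁'
    by_cases hc3 : 3 ≤ D.c ε
    · obtain ⟨S₂, g₂, e₂, n₂, n₂', d₂⟩ := e₁.valid.exists_extends_edge (k + 1) (ε := ε)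
        (by omega) (by omega)
      obtain ⟨g, hg, hgood⟩ := e₂.valid.exists_good hε (by omega) (by omega)
      have := e₂.edges_le k
      exact ⟨g, hg, hgood 1 k (by omega), hgood 1 _ (by omega)⟩
    · obtain ⟨S₂, g₂, e₂, n₂, n₂', d₂⟩ := e₁.valid.exists_extends_edge (k + 1) (ε := -ε)
        (by omega) (by rw [neg_neg]; omega)
      rw [neg_neg] at n₂'
      obtain ⟨g, hg, hgood⟩ := e₂.valid.exists_good hε (by omega) (by omega)
      have := e₂.edges_le k
      exact ⟨g, hg, hgood 1 k (by omega), hgood 1 _ (by omega)⟩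
  · suffices H : ∃ g, D.Valid Finset.univ g ∧ D.Good 1 g k by
      obtain ⟨g, hg, h1⟩ := H
      refine ⟨g, hg, fun k' hk' => ?_⟩
      rcases zmod_two_eq_or_eq_add_one k k' with rfl | rfl
      · exact h1
      · omega
    by_cases hc0 : D.c (-ε) = 0
    · obtain ⟨S₁, g₁, e₁, n₁, d₁, v₁⟩ := h0.exists_covered hε (k := k)
        (by rw [count_empty]; omega) hc0 (fun v _ => henc k v) (by rw [count_empty]; omega)
      rw [count_empty] at n₁
      obtain ⟨g, hg, hgood⟩ := e₁.valid.exists_good_of_covered hε (by omega) hc0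
      exact ⟨g, hg, hgood 1 k (by omega) v₁⟩
    by_cases hc1 : D.c ε = 1
    · obtain ⟨j₀, -, hj₀⟩ := exists_notMem_par (D := D) (S := ∅) (ε := ε)
        (by rw [count_empty]; omega)
      obtain ⟨j₁, -, hj₁⟩ := exists_notMem_par (D := D) (S := ∅) (ε := -ε)
        (by rw [count_empty]; omega)
      obtain ⟨j, x, hx, hxF⟩ := hbad k hl (by omega) j₀ j₁ (by rw [hj₁]; exact par_ne_neg hj₀)
      refine exists_good_one_of_two k hl (by omega) (fun δ hδ => ?_) hx hxF
      have : δ = ε ∨ δ = -ε := by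
        rcases hε with rfl | rfl <;> rcases hδ with rfl | rfl <;> simp
      rcases this with rfl | rfl <;> omega
    obtain ⟨S₁, g₁, e₁, n₁, n₁', d₁⟩ := h0.exists_extends_edge k (ε := ε)
      (by rw [count_empty]; omega) (by rw [count_empty]; omega)
    rw [count_empty] at n₁ n₁'
    obtain ⟨g, hg, hgood⟩ := e₁.valid.exists_good hε (by omega) (by omega)
    exact ⟨g, hg, hgood 1 k (by omega)⟩

end CrossingData

/-! ### Deleting and inserting a coordinate -/

section Coordinates

variable {m : ℕ} (i : Fin (m + 1))

theorem insertNth_injective_vert (k : ZMod 2) :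
    Function.Injective (fun x : Vert m => (i.insertNth k x : Vert (m + 1))) := by
  intro x y h
  have := congrArg i.removeNth h
  simpa using this

theorem insertNth_removeNth_of_eq {k : ZMod 2} {v : Vert (m + 1)} (h : v i = k) :
    (i.insertNth k (i.removeNth v) : Vert (m + 1)) = v := by
  rw [← h]; exact Fin.insertNth_self_removeNth i v

theorem insertNth_add_unitVec (k : ZMod 2) (x : Vert m) :
    (i.insertNth k x : Vert (m + 1)) + unitVec i = i.insertNth (k + 1) x := by
  ext j
  rcases Fin.eq_self_or_eq_succAbove i j with rfl | ⟨j, rfl⟩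
  · simp [unitVec]
  · simp [unitVec]

theorem insertNth_add_unitVec_succAbove (k : ZMod 2) (x : Vert m) (j : Fin m) :
    (i.insertNth k x : Vert (m + 1)) + unitVec (i.succAbove j) =
      i.insertNth k (x + unitVec j) := by
  ext l
  rcases Fin.eq_self_or_eq_succAbove i l with rfl | ⟨l, rfl⟩
  · simp [unitVec]
  · by_cases h : l = j
    · subst h; simp [unitVec]
    · have : i.succAbove l ≠ i.succAbove j := fun e => h (Fin.succAbove_right_injective e)
      simp [unitVec, Pi.single_eq_of_ne h, Pi.single_eq_of_ne this]

theorem mem_nbrs_insertNth {k : ZMod 2} {x : Vert m} {w : Vert (m + 1)} :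
    w ∈ nbrs (i.insertNth k x : Vert (m + 1)) ↔
      w = i.insertNth (k + 1) x ∨ ∃ y ∈ nbrs x, w = i.insertNth k y := by
  simp only [nbrs, Finset.mem_image, Finset.mem_univ, true_and]
  constructor
  · rintro ⟨j, rfl⟩
    rcases Fin.eq_self_or_eq_succAbove i j with rfl | ⟨j, rfl⟩
    · exact Or.inl (insertNth_add_unitVec _ k x)
    · exact Or.inr ⟨_, ⟨j, rfl⟩, insertNth_add_unitVec_succAbove i k x j⟩
  · rintro (rfl | ⟨y, ⟨j, rfl⟩, rfl⟩)
    · exact ⟨i, insertNth_add_unitVec i k x⟩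
    · exact ⟨i.succAbove j, insertNth_add_unitVec_succAbove i k x j⟩

theorem insertNth_mem_nbrs_insertNth {k : ZMod 2} {x y : Vert m} :
    (i.insertNth k y : Vert (m + 1)) ∈ nbrs (i.insertNth k x : Vert (m + 1)) ↔ y ∈ nbrs x := by
  rw [mem_nbrs_insertNth]
  constructor
  · rintro (h | ⟨z, hz, h⟩)
    · have := congrFun h i
      simp at this
    · rwa [insertNth_injective_vert i k h]
  · exact fun h => Or.inr ⟨y, h, rfl⟩

theorem isEdgePair_mk {n : ℕ} {α β : Vert n} : IsEdgePair s(α, β) ↔ β ∈ nbrs α := by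
  rw [mem_nbrs_iff]; exact SimpleGraph.mem_edgeSet _

theorem parity_insertNth (k : ZMod 2) (x : Vert m) :
    parity (i.insertNth k x : Vert (m + 1)) = (-1) ^ k.val * parity x := by
  rw [parity_eq_mul_removeNth i]; simp

end Coordinates

/-! ### Crossing pairs -/

section Crossing

variable {m : ℕ} (i : Fin (m + 1)) (A : Finset (Pair (m + 1)))

/-- The pairs of `A` whose ends differ in the `i`-th coordinate. -/
def cross : Finset (Pair (m + 1)) :=
  A.filter fun p => ¬ (∀ v ∈ p, v i = 0) ∧ ¬ ∀ v ∈ p, v i = 1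

open Classical in
/-- A vertex of the pair `p` with `i`-th coordinate `k`, if there is one. -/
noncomputable def crossEnd (k : ZMod 2) (p : Pair (m + 1)) : Vert (m + 1) :=
  if h : ∃ v ∈ p, v i = k then h.choose else 0

variable {A}

theorem mem_side {k : ZMod 2} {p : Pair (m + 1)} :
    p ∈ side i k A ↔ p ∈ A ∧ ∀ v ∈ p, v i = k := by
  simp [side]

theorem mem_side_or_mem_cross (k : ZMod 2) {p : Pair (m + 1)} (hp : p ∈ A) :
    p ∈ side i k A ∨ p ∈ side i (k + 1) A ∨ p ∈ cross i A := by
  simp only [mem_side, cross, Finset.mem_filter]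
  rcases zmod_two_eq k with rfl | rfl
  · rw [zero_add]; tauto
  · rw [show (1 : ZMod 2) + 1 = 0 by decide]; tauto

theorem exists_mem_of_mem_cross {p : Pair (m + 1)} (hp : p ∈ cross i A) (k : ZMod 2) :
    ∃ v ∈ p, v i = k := by
  simp only [cross, Finset.mem_filter, not_forall] at hp
  obtain ⟨-, ⟨v, hv, hv0⟩, ⟨w, hw, hw1⟩⟩ := hp
  rcases zmod_two_eq k with rfl | rfl
  · exact ⟨w, hw, (zmod_two_eq (w i)).resolve_right hw1⟩
  · exact ⟨v, hv, (zmod_two_eq (v i)).resolve_left hv0⟩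

theorem crossEnd_mem {p : Pair (m + 1)} (hp : p ∈ cross i A) (k : ZMod 2) :
    crossEnd i k p ∈ p := by
  have h := exists_mem_of_mem_cross i hp k
  rw [crossEnd, dif_pos h]
  exact h.choose_spec.1

theorem crossEnd_apply {p : Pair (m + 1)} (hp : p ∈ cross i A) (k : ZMod 2) :
    crossEnd i k p i = k := by
  have h := exists_mem_of_mem_cross i hp k
  rw [crossEnd, dif_pos h]
  exact h.choose_spec.2

theorem mk_crossEnd {p : Pair (m + 1)} (hp : p ∈ cross i A) (k : ZMod 2) :
    s(crossEnd i k p, crossEnd i (k + 1) p) = p := by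
  refine ((Sym2.mem_and_mem_iff fun h => ?_).1 ⟨crossEnd_mem i hp k, crossEnd_mem i hp (k + 1)⟩).symm
  have := congrFun h i
  rw [crossEnd_apply i hp, crossEnd_apply i hp] at this
  simp at this

theorem eq_crossEnd {p : Pair (m + 1)} (hp : p ∈ cross i A) {k : ZMod 2} {v : Vert (m + 1)}
    (hv : v ∈ p) (hk : v i = k) : v = crossEnd i k p := by
  rw [← mk_crossEnd i hp k, Sym2.mem_iff] at hv
  rcases hv with h | h
  · exact h
  · rw [h, crossEnd_apply i hp] at hk
    simp at hk

theorem cross_subset : cross i A ⊆ A := Finset.filter_subset _ _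

theorem notMem_side_of_mem_cross {p : Pair (m + 1)} (hp : p ∈ cross i A) (k : ZMod 2) :
    p ∉ side i k A := by
  intro h
  have h1 := (mem_side i).1 h |>.2 _ (crossEnd_mem i hp (k + 1))
  rw [crossEnd_apply i hp] at h1
  simp at h1

theorem eq_of_mem_of_mem (hA : IsPairSet A) {p q : Pair (m + 1)} (hp : p ∈ A) (hq : q ∈ A)
    {v : Vert (m + 1)} (hvp : v ∈ p) (hvq : v ∈ q) : p = q := by
  by_contra h
  exact hA.1 p hp q hq h v hvp hvq

theorem eq_of_parity_eq {n : ℕ} {p : Pair n} (hp : IsOddPair p) {v w : Vert n} (hv : v ∈ p)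
    (hw : w ∈ p) (h : parity v = parity w) : v = w := by
  by_contra hne
  rw [(Sym2.mem_and_mem_iff hne).1 ⟨hv, hw⟩] at hp
  exact hp h

theorem card_eq_card_sides_add : A.card =
    (side i 0 A).card + (side i 1 A).card + (cross i A).card := by
  have h1 := Finset.card_filter_add_card_filter_not (s := A) (fun p => ∀ v ∈ p, v i = 0)
  have h2 := Finset.card_filter_add_card_filter_not
    (s := A.filter fun p => ¬ ∀ v ∈ p, v i = 0) (fun p => ∀ v ∈ p, v i = 1)
  rw [Finset.filter_filter, Finset.filter_filter] at h2
  have h3 : (A.filter fun p => (¬ ∀ v ∈ p, v i = 0) ∧ ∀ v ∈ p, v i = 1) = side i 1 A := by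
    refine Finset.filter_congr fun p _ => ⟨fun h => h.2, fun h => ⟨fun h0 => ?_, h⟩⟩
    obtain ⟨v, hv⟩ : ∃ v, v ∈ p := ⟨_, Sym2.out_fst_mem p⟩
    have := h v hv
    rw [h0 v hv] at this
    exact zero_ne_one this
  rw [h3] at h2
  rw [side, cross]
  omega

variable (A) in
open Classical in
/-- The vertices of the `k`-th half that belong to pairs inside this half. -/
noncomputable def sideVerts (k : ZMod 2) : Finset (Vert m) :=
  Finset.univ.filter fun x => ∃ p ∈ side i k A, (i.insertNth k x : Vert (m + 1)) ∈ p

theorem mem_sideVerts {k : ZMod 2} {x : Vert m} :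
    x ∈ sideVerts i A k ↔ ∃ p ∈ side i k A, (i.insertNth k x : Vert (m + 1)) ∈ p := by
  simp [sideVerts]

theorem card_sideVerts_filter_le (hA : IsOdd A) (k : ZMod 2) (ε : ℤ) :
    ((sideVerts i A k).filter fun v => parity v = ε).card ≤ (side i k A).card := by
  have h : ∀ x ∈ (sideVerts i A k).filter (fun v => parity v = ε),
      ∃ p ∈ side i k A, (i.insertNth k x : Vert (m + 1)) ∈ p :=
    fun x hx => (mem_sideVerts i).1 (Finset.mem_filter.1 hx).1
  choose! f hf hf' using h
  refine Finset.card_le_card_of_injOn f hf fun x hx y hy hxy => ?_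
  have hx' := hf' x hx
  rw [hxy] at hx'
  refine insertNth_injective_vert i k (eq_of_parity_eq
    (hA.2 _ ((mem_side i).1 (hf y hy)).1) hx' (hf' y hy) ?_)
  rw [parity_insertNth, parity_insertNth, (Finset.mem_filter.1 hx).2, (Finset.mem_filter.1 hy).2]

theorem parity_crossEnd {p : Pair (m + 1)} (hp : p ∈ cross i A) (k : ZMod 2) :
    parity (crossEnd i k p) = (-1) ^ k.val * parity (i.removeNth (crossEnd i k p)) := by
  rw [parity_eq_mul_removeNth i, crossEnd_apply i hp]

theorem parity_removeNth_crossEnd (hA : IsOdd A) {p : Pair (m + 1)} (hp : p ∈ cross i A)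
    (k : ZMod 2) :
    parity (i.removeNth (crossEnd i k p)) = parity (i.removeNth (crossEnd i 0 p)) := by
  rcases zmod_two_eq k with rfl | rfl
  · rfl
  have h := hA.2 p (cross_subset i hp)
  rw [← mk_crossEnd i hp 0, zero_add] at h
  have h' := parity_eq_neg_of_ne (α := crossEnd i 0 p) (β := crossEnd i 1 p) h
  rw [parity_crossEnd i hp, parity_crossEnd i hp] at h'
  have h0 : (0 : ZMod 2).val = 0 := by decide
  have h1 : (1 : ZMod 2).val = 1 := by decide
  rw [h0, h1] at h'
  linarith

/-- The data for the choice of the new vertices in a simple `i`-completion of `A`. -/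
noncomputable def crossingData (hA : IsOdd A) (hm : 5 ≤ m)
    (hle : ∀ k, (side i k A).card + (cross i A).card ≤ m) : CrossingData m (cross i A) where
  le_dim := hm
  P := sideVerts i A
  a k p := i.removeNth (crossEnd i k p)
  par p := parity (i.removeNth (crossEnd i 0 p))
  n k := (side i k A).card
  parity_a k p := parity_removeNth_crossEnd i hA p.2 k
  a_injective k p q h := by
    have h' : crossEnd i k p = crossEnd i k q := by
      rw [← insertNth_removeNth_of_eq i (crossEnd_apply i p.2 k),
        ← insertNth_removeNth_of_eq i (crossEnd_apply i q.2 k)]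
      exact congrArg _ h
    refine Subtype.ext (eq_of_mem_of_mem hA.1 (cross_subset i p.2) (cross_subset i q.2)
      (crossEnd_mem i p.2 k) ?_)
    rw [h']
    exact crossEnd_mem i q.2 k
  card_P_le k ε _ := card_sideVerts_filter_le i hA k ε
  card_le k := by rw [Fintype.card_coe]; exact hle k

theorem insertNth_mem_verts_iff (hA : IsOdd A) (hm : 5 ≤ m)
    (hle : ∀ k, (side i k A).card + (cross i A).card ≤ m) {k : ZMod 2} {x : Vert m} :
    (i.insertNth k x : Vert (m + 1)) ∈ verts A ↔ x ∈ (crossingData i hA hm hle).U k := by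
  rw [CrossingData.U, Finset.mem_union, Finset.mem_image]
  change _ ↔ x ∈ sideVerts i A k ∨ ∃ p : cross i A, p ∈ Finset.univ ∧
    i.removeNth (crossEnd i k p) = x
  rw [mem_sideVerts]
  constructor
  · rintro ⟨p, hp, hx⟩
    rcases mem_side_or_mem_cross i k hp with h | h | h
    · exact Or.inl ⟨p, h, hx⟩
    · have := ((mem_side i).1 h).2 _ hx
      simp at this
    · refine Or.inr ⟨⟨p, h⟩, Finset.mem_univ _, ?_⟩
      rw [← eq_crossEnd i h hx (by simp)]
      simp
  · rintro (⟨p, hp, hx⟩ | ⟨p, -, rfl⟩)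
    · exact ⟨p, ((mem_side i).1 hp).1, hx⟩
    · rw [insertNth_removeNth_of_eq i (crossEnd_apply i p.2 k)]
      exact ⟨p, cross_subset i p.2, crossEnd_mem i p.2 k⟩

end Crossing

/-! ### The simple completion given by a choice of new vertices -/

section Completion

variable {m : ℕ} (i : Fin (m + 1)) {A : Finset (Pair (m + 1))}

/-- The pair in the `k`-th half that replaces a crossing pair, for the new vertex `g p` (with the
`i`-th coordinate deleted). -/
noncomputable def newPair (g : cross i A → Vert m) (k : ZMod 2) (p : cross i A) : Pair (m + 1) :=
  s(crossEnd i k p, i.insertNth k (g p))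

open Classical in
/-- The pairs that replace a given pair of `A`. -/
noncomputable def treat (g : cross i A → Vert m) (p : Pair (m + 1)) : Finset (Pair (m + 1)) :=
  if h : p ∈ cross i A then {newPair i g 0 ⟨p, h⟩, newPair i g 1 ⟨p, h⟩} else {p}

/-- The completion of `A` given by the new vertices `g`. -/
noncomputable def completion (g : cross i A → Vert m) : Finset (Pair (m + 1)) :=
  A.biUnion (treat i g)

/-- The conditions on the new vertices in a simple `i`-completion. -/
structure Admissible (g : cross i A → Vert m) : Prop where
  notMem : ∀ p k, (i.insertNth k (g p) : Vert (m + 1)) ∉ verts A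
  parity_ne : ∀ p : cross i A, ∀ k,
    parity (crossEnd i k p) ≠ parity (i.insertNth k (g p) : Vert (m + 1))
  injective : Function.Injective g

variable {i} {g : cross i A → Vert m}

theorem mem_treat {p q : Pair (m + 1)} : q ∈ treat i g p ↔
    (p ∉ cross i A ∧ q = p) ∨ ∃ h : p ∈ cross i A, ∃ k, q = newPair i g k ⟨p, h⟩ := by
  by_cases h : p ∈ cross i A
  · rw [treat, dif_pos h, Finset.mem_insert, Finset.mem_singleton]
    constructor
    · rintro (rfl | rfl)
      exacts [Or.inr ⟨h, 0, rfl⟩, Or.inr ⟨h, 1, rfl⟩]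
    · rintro (⟨h', -⟩ | ⟨_, k, rfl⟩)
      · exact absurd h h'
      · rcases zmod_two_eq k with rfl | rfl <;> simp
  · rw [treat, dif_neg h, Finset.mem_singleton]
    simp [h]

theorem mem_newPair {k : ZMod 2} {p : cross i A} {v : Vert (m + 1)} :
    v ∈ newPair i g k p ↔ v = crossEnd i k p ∨ v = i.insertNth k (g p) := Sym2.mem_iff

theorem apply_of_mem_newPair {k : ZMod 2} {p : cross i A} {v : Vert (m + 1)}
    (hv : v ∈ newPair i g k p) : v i = k := by
  rcases mem_newPair.1 hv with rfl | rfl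
  · exact crossEnd_apply i p.2 k
  · simp

theorem mem_or_of_mem_treat {p q : Pair (m + 1)} (hq : q ∈ treat i g p) {v : Vert (m + 1)}
    (hv : v ∈ q) : v ∈ p ∨ ∃ h : p ∈ cross i A, ∃ k, v = i.insertNth k (g ⟨p, h⟩) := by
  rcases mem_treat.1 hq with ⟨-, rfl⟩ | ⟨h, k, rfl⟩
  · exact Or.inl hv
  · rcases mem_newPair.1 hv with rfl | rfl
    · exact Or.inl (crossEnd_mem i h k)
    · exact Or.inr ⟨h, k, rfl⟩

theorem Admissible.eq_of_insertNth_eq (hg : Admissible i g) {p q : cross i A} {k l : ZMod 2}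
    (h : (i.insertNth k (g p) : Vert (m + 1)) = i.insertNth l (g q)) : p = q := by
  have := congrArg i.removeNth h
  simp only [Fin.removeNth_insertNth] at this
  exact hg.injective this

theorem Admissible.eq_of_mem_treat (hA : IsOdd A) (hg : Admissible i g) {p p' q q' : Pair (m + 1)}
    (hp : p ∈ A) (hp' : p' ∈ A) (hq : q ∈ treat i g p) (hq' : q' ∈ treat i g p')
    {v : Vert (m + 1)} (hv : v ∈ q) (hv' : v ∈ q') : p = p' := by
  rcases mem_or_of_mem_treat hq hv with h | ⟨h, k, rfl⟩
  · rcases mem_or_of_mem_treat hq' hv' with h' | ⟨h', k', rfl⟩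
    · exact eq_of_mem_of_mem hA.1 hp hp' h h'
    · exact absurd ⟨p, hp, h⟩ (hg.notMem _ _)
  · rcases mem_or_of_mem_treat hq' hv' with h' | ⟨h', k', e⟩
    · exact absurd ⟨p', hp', h'⟩ (hg.notMem _ _)
    · exact congrArg Subtype.val (hg.eq_of_insertNth_eq e)

theorem not_isDiag_of_isOddPair {n : ℕ} {p : Pair n} (hp : IsOddPair p) : ¬ p.IsDiag := by
  obtain ⟨v, hv⟩ : ∃ v, v ∈ p := ⟨_, Sym2.out_fst_mem p⟩
  obtain ⟨w, rfl⟩ := hv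
  rintro h
  rw [Sym2.mk_isDiag_iff] at h
  exact hp (congrArg parity h)

/-- Disjoint odd pairs form an odd pair-set, as an odd pair is nondegenerate. -/
theorem isOdd_of {n : ℕ} {B : Finset (Pair n)}
    (hdisj : ∀ p ∈ B, ∀ q ∈ B, ∀ v ∈ p, v ∈ q → p = q) (hodd : ∀ p ∈ B, IsOddPair p) :
    IsOdd B :=
  ⟨⟨fun p hp q hq hne v hv hv' => hne (hdisj p hp q hq v hv hv'),
    fun ⟨p, hp⟩ => ⟨p, hp, not_isDiag_of_isOddPair (hodd p hp)⟩⟩, hodd⟩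

theorem Admissible.isOdd_completion (hA : IsOdd A) (hg : Admissible i g) :
    IsOdd (completion i g) := by
  refine isOdd_of ?_ ?_
  · intro q hq q' hq' v hv hv'
    obtain ⟨p, hp, hqp⟩ := Finset.mem_biUnion.1 hq
    obtain ⟨p', hp', hqp'⟩ := Finset.mem_biUnion.1 hq'
    obtain rfl := hg.eq_of_mem_treat hA hp hp' hqp hqp' hv hv'
    rcases mem_treat.1 hqp with ⟨h, rfl⟩ | ⟨h, k, rfl⟩
    · rcases mem_treat.1 hqp' with ⟨-, rfl⟩ | ⟨h', -⟩
      · rfl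
      · exact absurd h' h
    · rcases mem_treat.1 hqp' with ⟨h', -⟩ | ⟨h', k', rfl⟩
      · exact absurd h h'
      · rw [← apply_of_mem_newPair hv, ← apply_of_mem_newPair hv']
  · intro q hq
    obtain ⟨p, hp, hqp⟩ := Finset.mem_biUnion.1 hq
    rcases mem_treat.1 hqp with ⟨h, rfl⟩ | ⟨h, k, rfl⟩
    · exact hA.2 _ hp
    · exact hg.parity_ne ⟨p, h⟩ k

theorem mem_side_completion {k : ZMod 2} {q : Pair (m + 1)} :
    q ∈ side i k (completion i g) ↔ q ∈ side i k A ∨ ∃ p, q = newPair i g k p := by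
  rw [mem_side, completion, Finset.mem_biUnion]
  constructor
  · rintro ⟨⟨p, hp, hq⟩, hk⟩
    rcases mem_treat.1 hq with ⟨-, rfl⟩ | ⟨h, l, rfl⟩
    · exact Or.inl ((mem_side i).2 ⟨hp, hk⟩)
    · have := hk _ (mem_newPair.2 (Or.inl rfl))
      rw [crossEnd_apply i h] at this
      subst this
      exact Or.inr ⟨_, rfl⟩
  · rintro (h | ⟨p, rfl⟩)
    · refine ⟨⟨q, ((mem_side i).1 h).1, mem_treat.2 (Or.inl ⟨fun hc => ?_, rfl⟩)⟩,
        ((mem_side i).1 h).2⟩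
      exact notMem_side_of_mem_cross i hc k h
    · exact ⟨⟨p, cross_subset i p.2, mem_treat.2 (Or.inr ⟨p.2, k, rfl⟩)⟩,
        fun v => apply_of_mem_newPair⟩

theorem Admissible.newPair_injective (hA : IsOdd A) (hg : Admissible i g) (k : ZMod 2) :
    Function.Injective (newPair i g k) := by
  intro p q h
  refine Subtype.ext (hg.eq_of_mem_treat hA (cross_subset i p.2) (cross_subset i q.2)
    (mem_treat.2 (Or.inr ⟨p.2, k, rfl⟩)) (mem_treat.2 (Or.inr ⟨q.2, k, h⟩))
    (mem_newPair.2 (Or.inl rfl)) (mem_newPair.2 (Or.inl rfl)))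

theorem Admissible.newPair_notMem (hg : Admissible i g) (k : ZMod 2) (p : cross i A) :
    newPair i g k p ∉ side i k A :=
  fun h => hg.notMem p k ⟨_, ((mem_side i).1 h).1, mem_newPair.2 (Or.inr rfl)⟩

theorem Admissible.card_side_completion (hA : IsOdd A) (hg : Admissible i g) (k : ZMod 2) :
    (side i k (completion i g)).card = (side i k A).card + (cross i A).card := by
  have h : side i k (completion i g) = side i k A ∪ Finset.univ.image (newPair i g k) := by
    ext q
    rw [mem_side_completion, Finset.mem_union, Finset.mem_image]
    simp only [Finset.mem_univ, true_and, eq_comm]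
  rw [h, Finset.card_union_of_disjoint, Finset.card_image_of_injective _ (hg.newPair_injective hA k),
    Finset.card_univ, Fintype.card_coe]
  rw [Finset.disjoint_right]
  intro q hq
  obtain ⟨p, -, rfl⟩ := Finset.mem_image.1 hq
  exact hg.newPair_notMem k p

theorem isEvenPair_of_mem (hA : IsOdd A) {p : Pair (m + 1)} (hp : p ∈ A) : ¬ IsEvenPair p :=
  fun h => h (hA.2 p hp)

theorem pairParity_eq_zero {n : ℕ} {p : Pair n} (hp : IsOddPair p) : pairParity p = 0 := by
  induction p using Sym2.ind with
  | _ x y =>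
    have h := parity_eq_neg_of_ne (α := x) (β := y) hp
    change parity x + parity y = 0
    omega

/-- The construction may treat the pairs in any order. All pairs are odd, so the matching on even
pairs is empty. -/
theorem Admissible.completion_mem (hA : IsOdd A) (hne : A.Nonempty) (hg : Admissible i g) :
    completion i g ∈ simpleCompletions i A := by
  refine ⟨hne, ⟨hA.1, Finset.sum_eq_zero fun p hp => pairParity_eq_zero (hA.2 p hp)⟩, ∅,
    ⟨by simp, fun p hp h => absurd h (isEvenPair_of_mem hA hp), by simp, by simp⟩, ?_⟩
  suffices H : ∀ T ⊆ A, Relation.ReflTransGen (CompletionStep i A ∅) (∅, A)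
      (T.biUnion (treat i g), A \ T) by
    simpa [completion] using H A subset_rfl
  intro T
  induction T using Finset.induction_on with
  | empty => intro _; simpa using Relation.ReflTransGen.refl
  | insert p T hpT ih =>
    intro hT
    have hpA : p ∈ A := hT (Finset.mem_insert_self p T)
    have hTA : T ⊆ A := (Finset.subset_insert p T).trans hT
    refine (ih hTA).tail ?_
    have hmem : p ∈ A \ T := Finset.mem_sdiff.2 ⟨hpA, hpT⟩
    rw [Finset.biUnion_insert, Finset.union_comm,
      show A \ insert p T = (A \ T) \ {p} by
        rw [sdiff_sdiff_left, Finset.insert_eq, Finset.union_comm]; rfl]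
    by_cases h : p ∈ cross i A
    · have hnew : ∀ l, (i.insertNth l (g ⟨p, h⟩) : Vert (m + 1)) ∉
          verts A ∪ verts (T.biUnion (treat i g)) := by
        rintro l (hl | ⟨q, hq, hl⟩)
        · exact hg.notMem _ _ hl
        · obtain ⟨p', hp', hq'⟩ := Finset.mem_biUnion.1 hq
          obtain rfl := hg.eq_of_mem_treat hA hpA (hTA hp')
            (mem_treat.2 (Or.inr ⟨h, l, rfl⟩)) hq' (mem_newPair.2 (Or.inr rfl)) hl
          exact hpT hp'
      have hmk := mk_crossEnd i h 0
      rw [zero_add] at hmk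
      have key := CompletionStep.oddSplit (i := i) (A := A) (R := ∅) (T.biUnion (treat i g)) (A \ T)
        (crossEnd i 0 p) (crossEnd i 1 p) (i.insertNth 0 (g ⟨p, h⟩)) (by rwa [hmk])
        (by rw [hmk]; exact hA.2 p hpA)
        (by rw [crossEnd_apply i h, crossEnd_apply i h]; exact zero_ne_one)
        (by rw [crossEnd_apply i h]; simp) (hg.parity_ne ⟨p, h⟩ 0)
        ⟨hnew 0, by rw [insertNth_add_unitVec]; exact hnew _⟩
      rw [hmk, insertNth_add_unitVec, zero_add] at key
      rw [treat, dif_pos h, newPair, newPair]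
      rwa [show s(i.insertNth 1 (g ⟨p, h⟩), crossEnd i 1 p) =
        s(crossEnd i 1 p, i.insertNth 1 (g ⟨p, h⟩)) from Sym2.eq_swap] at key
    · rw [treat, dif_neg h]
      obtain ⟨α, β, rfl⟩ : ∃ α β, p = s(α, β) := by
        induction p using Sym2.ind with
        | _ x y => exact ⟨x, y, rfl⟩
      refine CompletionStep.oddKeep _ _ α β hmem (hA.2 _ hpA) ?_
      have h' : s(α, β) ∈ side i 0 A ∨ s(α, β) ∈ side i 1 A := by
        have := mem_side_or_mem_cross i 0 hpA
        rw [zero_add] at this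
        tauto
      rcases h' with h' | h' <;>
        rw [((mem_side i).1 h').2 α (Sym2.mem_mk_left _ _),
          ((mem_side i).1 h').2 β (Sym2.mem_mk_right _ _)]

/-! ### The halves of the completion -/

theorem mem_map_removeNth {k : ZMod 2} {q : Pair (m + 1)} (hq : ∀ v ∈ q, v i = k) {x : Vert m} :
    x ∈ Sym2.map (fun α : Vert (m + 1) => i.removeNth α) q ↔
      (i.insertNth k x : Vert (m + 1)) ∈ q := by
  rw [Sym2.mem_map]
  constructor
  · rintro ⟨v, hv, rfl⟩
    rwa [insertNth_removeNth_of_eq i (hq v hv)]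
  · exact fun h => ⟨_, h, by simp⟩

theorem map_removeNth_eq {k : ZMod 2} {q : Pair (m + 1)} (hq : ∀ v ∈ q, v i = k) :
    ∃ x y : Vert m, q = s(i.insertNth k x, i.insertNth k y) ∧
      Sym2.map (fun α : Vert (m + 1) => i.removeNth α) q = s(x, y) := by
  induction q using Sym2.ind with
  | _ v w =>
    refine ⟨i.removeNth v, i.removeNth w, ?_, rfl⟩
    rw [insertNth_removeNth_of_eq i (hq v (Sym2.mem_mk_left _ _)),
      insertNth_removeNth_of_eq i (hq w (Sym2.mem_mk_right _ _))]

theorem map_removeNth_injOn {B : Finset (Pair (m + 1))} (k : ZMod 2) :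
    Set.InjOn (Sym2.map fun α : Vert (m + 1) => i.removeNth α) (side i k B : Set (Pair (m + 1))) := by
  intro q hq q' hq' h
  have hq := ((mem_side i).1 hq).2
  have hq' := ((mem_side i).1 hq').2
  ext v
  have key : ∀ v, v i = k → (v ∈ q ↔ v ∈ q') := by
    intro v hv
    rw [← insertNth_removeNth_of_eq i hv, ← mem_map_removeNth hq, ← mem_map_removeNth hq', h]
  exact ⟨fun hv => (key v (hq v hv)).1 hv, fun hv => (key v (hq' v hv)).2 hv⟩

theorem mem_verts_rho {B : Finset (Pair (m + 1))} {k : ZMod 2} {x : Vert m} :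
    x ∈ verts (rho i k B) ↔ ∃ q ∈ side i k B, (i.insertNth k x : Vert (m + 1)) ∈ q := by
  constructor
  · rintro ⟨r, hr, hx⟩
    obtain ⟨q, hq, rfl⟩ := Finset.mem_image.1 hr
    exact ⟨q, hq, (mem_map_removeNth ((mem_side i).1 hq).2).1 hx⟩
  · rintro ⟨q, hq, hx⟩
    exact ⟨_, Finset.mem_image_of_mem _ hq, (mem_map_removeNth ((mem_side i).1 hq).2).2 hx⟩

theorem isOdd_rho {B : Finset (Pair (m + 1))} (hB : IsOdd B) (k : ZMod 2) : IsOdd (rho i k B) := by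
  refine isOdd_of ?_ ?_
  · intro r hr r' hr' v hv hv'
    obtain ⟨q, hq, rfl⟩ := Finset.mem_image.1 hr
    obtain ⟨q', hq', rfl⟩ := Finset.mem_image.1 hr'
    rw [mem_side] at hq hq'
    rw [eq_of_mem_of_mem hB.1 hq.1 hq'.1 ((mem_map_removeNth hq.2).1 hv)
      ((mem_map_removeNth hq'.2).1 hv')]
  · intro r hr
    obtain ⟨q, hq, rfl⟩ := Finset.mem_image.1 hr
    rw [mem_side] at hq
    obtain ⟨x, y, rfl, h⟩ := map_removeNth_eq hq.2
    rw [h]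
    intro hxy
    refine hB.2 _ hq.1 ?_
    rw [parity_insertNth, parity_insertNth, hxy]

theorem card_rho (B : Finset (Pair (m + 1))) (k : ZMod 2) :
    (rho i k B).card = (side i k B).card := Finset.card_image_of_injOn (map_removeNth_injOn k)

theorem isEdgePair_map_removeNth {k : ZMod 2} {q : Pair (m + 1)} (hq : ∀ v ∈ q, v i = k)
    (he : IsEdgePair q) : IsEdgePair (Sym2.map (fun α : Vert (m + 1) => i.removeNth α) q) := by
  obtain ⟨x, y, rfl, h⟩ := map_removeNth_eq hq
  rw [h, isEdgePair_mk]
  rwa [isEdgePair_mk, insertNth_mem_nbrs_insertNth] at he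

/-- Every half of an odd pair-set with at most `m` pairs inside it is diminishable if, in case of
equality, it has two edge-pairs and encompasses no vertex. -/
theorem isDiminishable_rho {B : Finset (Pair (m + 1))} (hB : IsOdd B) (hm : 5 ≤ m) (k : ZMod 2)
    (hcard : (side i k B).card ≤ m)
    (hedge : (side i k B).card = m → ∃ p ∈ side i k B, ∃ q ∈ side i k B,
      p ≠ q ∧ IsEdgePair p ∧ IsEdgePair q)
    (henc : (side i k B).card = m → enc (verts (rho i k B)) = ∅) :
    IsDiminishable (rho i k B) := by
  refine ⟨isOdd_rho hB k, ?_⟩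
  rw [card_rho]
  rcases hcard.lt_or_eq with h | h
  · exact Or.inl ⟨h, fun h4 => by omega⟩
  · refine Or.inr ⟨h, by omega, ?_, henc h⟩
    obtain ⟨p, hp, q, hq, hne, hpe, hqe⟩ := hedge h
    exact ⟨_, Finset.mem_image_of_mem _ hp, _, Finset.mem_image_of_mem _ hq,
      fun e => hne (map_removeNth_injOn k hp hq e),
      isEdgePair_map_removeNth ((mem_side i).1 hp).2 hpe,
      isEdgePair_map_removeNth ((mem_side i).1 hq).2 hqe⟩

end Completion

/-! ### From choices of new vertices to completions -/

section Assembly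

variable {m : ℕ} {i : Fin (m + 1)} {A : Finset (Pair (m + 1))} {hA : IsOdd A} {hm : 5 ≤ m}
  {hle : ∀ k, (side i k A).card + (cross i A).card ≤ m} {g : cross i A → Vert m}

theorem admissible_of_valid (hg : (crossingData i hA hm hle).Valid Finset.univ g) :
    Admissible i g := by
  refine ⟨fun p k h => ?_, fun p k => ?_, fun p q h => hg.injOn (by simp) (by simp) h⟩
  · rw [insertNth_mem_verts_iff i hA hm hle] at h
    exact hg.notMem p (Finset.mem_univ p) (CrossingData.U_subset_F _ k h)
  · have h : parity (g p) = -parity (i.removeNth (crossEnd i 0 p)) :=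
      hg.parity_eq p (Finset.mem_univ p)
    rw [parity_insertNth, h, parity_crossEnd i p.2, parity_removeNth_crossEnd i hA p.2]
    intro h'
    exact parity_ne_neg _ (mul_left_cancel₀ (pow_ne_zero _ (by norm_num)) h')

theorem mem_verts_rho_completion {k : ZMod 2} {x : Vert m} :
    x ∈ verts (rho i k (completion i g)) ↔ x ∈ (crossingData i hA hm hle).X k g := by
  rw [mem_verts_rho, CrossingData.X, Finset.mem_union, Finset.mem_image]
  constructor
  · rintro ⟨q, hq, hx⟩
    rcases mem_side_completion.1 hq with hq | ⟨p, rfl⟩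
    · rw [← insertNth_mem_verts_iff i hA hm hle]
      exact Or.inl ⟨q, ((mem_side i).1 hq).1, hx⟩
    · rcases mem_newPair.1 hx with hx | hx
      · rw [← insertNth_mem_verts_iff i hA hm hle, hx]
        exact Or.inl ⟨p, cross_subset i p.2, crossEnd_mem i p.2 k⟩
      · exact Or.inr ⟨p, Finset.mem_univ p, (insertNth_injective_vert i k hx).symm⟩
  · rintro (hx | ⟨p, -, rfl⟩)
    · rcases Finset.mem_union.1 hx with hx | hx
      · obtain ⟨q, hq, hx⟩ := (mem_sideVerts i).1 hx
        exact ⟨q, mem_side_completion.2 (Or.inl hq), hx⟩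
      · obtain ⟨p, -, rfl⟩ := Finset.mem_image.1 hx
        refine ⟨_, mem_side_completion.2 (Or.inr ⟨p, rfl⟩), mem_newPair.2 (Or.inl ?_)⟩
        exact insertNth_removeNth_of_eq i (crossEnd_apply i p.2 k)
    · exact ⟨_, mem_side_completion.2 (Or.inr ⟨p, rfl⟩), mem_newPair.2 (Or.inr rfl)⟩

theorem enc_eq_empty_of_good {t : ℕ} {k : ZMod 2} (h : (crossingData i hA hm hle).Good t g k) :
    enc (verts (rho i k (completion i g))) = ∅ := by
  rw [Set.eq_empty_iff_forall_notMem]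
  rintro v ⟨hv, hn⟩
  rw [mem_verts_rho_completion (hA := hA) (hm := hm) (hle := hle)] at hv
  refine hv (h.2 v fun w hw => ?_)
  rw [← mem_verts_rho_completion]
  exact hn w (mem_nbrs_iff.1 hw)

theorem isEdgePair_newPair {k : ZMod 2} {p : cross i A}
    (h : g p ∈ nbrs ((crossingData i hA hm hle).a k p)) : IsEdgePair (newPair i g k p) := by
  rw [newPair, isEdgePair_mk, ← insertNth_removeNth_of_eq i (crossEnd_apply i p.2 k),
    insertNth_mem_nbrs_insertNth]
  exact h

theorem exists_isEdgePair_of_good_two {k : ZMod 2}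
    (hg : (crossingData i hA hm hle).Valid Finset.univ g)
    (h : (crossingData i hA hm hle).Good 2 g k) :
    ∃ p ∈ side i k (completion i g), ∃ q ∈ side i k (completion i g),
      p ≠ q ∧ IsEdgePair p ∧ IsEdgePair q := by
  obtain ⟨p, hp, q, hq, hne⟩ := Finset.one_lt_card.1 h.1
  exact ⟨_, mem_side_completion.2 (Or.inr ⟨p, rfl⟩), _, mem_side_completion.2 (Or.inr ⟨q, rfl⟩),
    ((admissible_of_valid hg).newPair_injective hA k).ne hne,
    isEdgePair_newPair (Finset.mem_filter.1 hp).2, isEdgePair_newPair (Finset.mem_filter.1 hq).2⟩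

theorem exists_isEdgePair_of_good_one {k : ZMod 2}
    (hg : (crossingData i hA hm hle).Valid Finset.univ g)
    (h : (crossingData i hA hm hle).Good 1 g k) (hs : ∃ p ∈ side i k A, IsEdgePair p) :
    ∃ p ∈ side i k (completion i g), ∃ q ∈ side i k (completion i g),
      p ≠ q ∧ IsEdgePair p ∧ IsEdgePair q := by
  obtain ⟨p, hp⟩ := Finset.card_pos.1 h.1
  obtain ⟨q, hq, hqe⟩ := hs
  exact ⟨_, mem_side_completion.2 (Or.inr ⟨p, rfl⟩), _, mem_side_completion.2 (Or.inl hq),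
    fun e => (admissible_of_valid hg).newPair_notMem k p (e ▸ hq),
    isEdgePair_newPair (Finset.mem_filter.1 hp).2, hqe⟩

/-- A valid choice of new vertices gives a completion with diminishable halves if it takes care of
the halves that have as many pairs as dimensions. -/
theorem exists_completion_of_valid (hA : IsOdd A) (hm : 5 ≤ m)
    (hle : ∀ k, (side i k A).card + (cross i A).card ≤ m) (hne : A.Nonempty)
    (hg : (crossingData i hA hm hle).Valid Finset.univ g) {t : ℕ}
    (hgood : ∀ k, (side i k A).card + (cross i A).card = m →
      (crossingData i hA hm hle).Good t g k ∧
      ∃ p ∈ side i k (completion i g), ∃ q ∈ side i k (completion i g),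
        p ≠ q ∧ IsEdgePair p ∧ IsEdgePair q) :
    ∃ B ∈ simpleCompletions i A, IsDiminishable (rho i 0 B) ∧ IsDiminishable (rho i 1 B) := by
  have hadm := admissible_of_valid hg
  have key : ∀ k, IsDiminishable (rho i k (completion i g)) := by
    intro k
    have hcard := hadm.card_side_completion hA k
    exact isDiminishable_rho (hadm.isOdd_completion hA) hm k (hcard ▸ hle k)
      (fun h => (hgood k (hcard ▸ h)).2) (fun h => enc_eq_empty_of_good (hgood k (hcard ▸ h)).1)
  exact ⟨_, hadm.completion_mem hA hne, key 0, key 1⟩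

/-- A vertex of a half whose opposite vertex is used by `A` has an unused neighbour in this half,
unless it is used itself. -/
theorem mem_U_of_enc_eq_empty (henc : enc (verts A) = ∅) (k : ZMod 2) (v : Vert m)
    (hv : nbrs v ⊆ (crossingData i hA hm hle).U k)
    (hv' : v ∈ (crossingData i hA hm hle).U (k + 1)) : v ∈ (crossingData i hA hm hle).U k := by
  by_contra hcon
  rw [← insertNth_mem_verts_iff] at hcon
  refine (Set.eq_empty_iff_forall_notMem.1 henc) _ ⟨hcon, fun β hβ => ?_⟩
  rw [← mem_nbrs_iff, mem_nbrs_insertNth] at hβ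
  rcases hβ with rfl | ⟨y, hy, rfl⟩
  · rwa [insertNth_mem_verts_iff i hA hm hle]
  · rw [insertNth_mem_verts_iff i hA hm hle]
    exact hv hy

/-- If only two pairs cross the `i`-th direction and `i` is not bad, then one of them has an end
in the `k`-th half with an unused neighbour. -/
theorem exists_nbr_of_not_isBad (hcard : A.card = m + 1) (hsep : IsSeparating i A)
    (hbad : ¬ IsBad i A) (k : ZMod 2) (hk : (side i (k + 1) A).card = 1)
    (hs : (cross i A).card = 2) (j₀ j₁ : cross i A)
    (hj : (crossingData i hA hm hle).par j₀ ≠ (crossingData i hA hm hle).par j₁) :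
    ∃ j, ∃ x ∈ nbrs ((crossingData i hA hm hle).a k j), x ∉ (crossingData i hA hm hle).F := by
  by_contra! hcon
  have hne : j₀ ≠ j₁ := fun h => hj (h ▸ rfl)
  have hall : ∀ p ∈ cross i A, p = j₀ ∨ p = j₁ := by
    intro p hp
    have h : ({j₀.1, j₁.1} : Finset (Pair (m + 1))) = cross i A := by
      refine Finset.eq_of_subset_of_card_le ?_ ?_
      · intro q hq
        rw [Finset.mem_insert, Finset.mem_singleton] at hq
        rcases hq with rfl | rfl
        exacts [j₀.2, j₁.2]
      · rw [hs, Finset.card_pair fun h => hne (Subtype.ext h)]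
    rw [← h] at hp
    simpa using hp
  obtain ⟨r, hr⟩ := Finset.card_eq_one.1 hk
  have hrs : r ∈ side i (k + 1) A := by rw [hr]; exact Finset.mem_singleton_self r
  obtain ⟨α₂, β₂, hr₂⟩ : ∃ α β, r = s(α, β) := by
    induction r using Sym2.ind with
    | _ x y => exact ⟨x, y, rfl⟩
  have hk1 : 1 - k = k + 1 := by rw [CharTwo.sub_eq_add, add_comm]
  have hrk := (mem_side i).1 hrs
  have hdist : ∀ j : cross i A, j.1 ≠ r := fun j h => notMem_side_of_mem_cross i j.2 (k + 1) (h ▸ hrs)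
  have hm₀ := mk_crossEnd i j₀.2 k
  have hm₁ := mk_crossEnd i j₁.2 k
  -- The neighbours of the ends in the `k`-th half are all in use.
  have key : ∀ j j' : cross i A, (∀ p ∈ cross i A, p = j ∨ p = j') → ∀ κ : Vert (m + 1), κ i = k →
      (hypercube (m + 1)).Adj κ (crossEnd i k j) →
      κ ∈ verts (A \ {j.1, j'.1, r}) ∨ κ = crossEnd i k j' ∨
        (κ + unitVec i ∈ r ∨ κ + unitVec i = crossEnd i (k + 1) j ∨
          κ + unitVec i = crossEnd i (k + 1) j') := by
    intro j j' hjj' κ hκ hadj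
    have hκ' := insertNth_removeNth_of_eq i hκ
    rw [← hκ'] at hadj ⊢
    generalize i.removeNth κ = x at *
    have hx : x ∈ nbrs ((crossingData i hA hm hle).a k j) := by
      rw [SimpleGraph.adj_comm, ← mem_nbrs_iff,
        ← insertNth_removeNth_of_eq i (crossEnd_apply i j.2 k),
        insertNth_mem_nbrs_insertNth] at hadj
      exact hadj
    have hF := hcon j x hx
    rw [insertNth_add_unitVec]
    rw [CrossingData.mem_F_iff _ k, ← insertNth_mem_verts_iff, ← insertNth_mem_verts_iff] at hF
    rcases hF with ⟨p, hp, hxp⟩ | ⟨p, hp, hxp⟩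
    · by_cases hp' : p ∈ ({j.1, j'.1, r} : Finset (Pair (m + 1)))
      · rw [Finset.mem_insert, Finset.mem_insert, Finset.mem_singleton] at hp'
        rcases hp' with rfl | rfl | rfl
        · rw [eq_crossEnd i (k := k) j.2 hxp (by simp)] at hadj
          exact absurd hadj (SimpleGraph.irrefl _)
        · exact Or.inr (Or.inl (eq_crossEnd i j'.2 hxp (by simp)))
        · have := hrk.2 _ hxp
          simp at this
      · exact Or.inl ⟨p, Finset.mem_sdiff.2 ⟨hp, hp'⟩, hxp⟩
    · right; right
      rcases mem_side_or_mem_cross i (k + 1) hp with h | h | h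
      · rw [hr, Finset.mem_singleton] at h
        exact Or.inl (h ▸ hxp)
      · have := ((mem_side i).1 h).2 _ hxp
        simp at this
      · right
        rcases hjj' p h with rfl | rfl
        · exact Or.inl (eq_crossEnd i j.2 hxp (by simp))
        · exact Or.inr (eq_crossEnd i j'.2 hxp (by simp))
  refine hbad ⟨hcard, hsep, k, ?_, by rw [hk1, hk], crossEnd i k j₀, crossEnd i (k + 1) j₀,
    crossEnd i k j₁, crossEnd i (k + 1) j₁, α₂, β₂, ?_⟩
  · have h := card_eq_card_sides_add (A := A) i
    rcases zmod_two_eq k with rfl | rfl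
    · rw [zero_add] at hk; omega
    · rw [show (1 : ZMod 2) + 1 = 0 by decide] at hk; omega
  rw [hm₀, hm₁, ← hr₂, hk1]
  refine ⟨cross_subset i j₀.2, cross_subset i j₁.2, hrk.1, fun h => hne (Subtype.ext h),
    hdist j₀, hdist j₁, crossEnd_apply i j₀.2 k, crossEnd_apply i j₁.2 k,
    crossEnd_apply i j₀.2 _, crossEnd_apply i j₁.2 _, hrk.2 α₂ (by simp [hr₂]),
    hrk.2 β₂ (by simp [hr₂]), ?_, ?_, ?_⟩
  · rw [parity_crossEnd i j₀.2, parity_crossEnd i j₁.2, parity_removeNth_crossEnd i hA j₀.2,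
      parity_removeNth_crossEnd i hA j₁.2]
    exact fun h => hj (mul_left_cancel₀ (pow_ne_zero _ (by norm_num)) h)
  · intro κ hκ hadj
    have := key j₀ j₁ hall κ hκ hadj
    rw [hr₂, Sym2.mem_iff] at this
    rw [hr₂]
    refine this.imp_right (Or.imp_right ?_)
    rintro ((h | h) | h | h) <;> rw [h] <;> simp
  · intro κ hκ hadj
    have := key j₁ j₀ (fun p hp => (hall p hp).symm) κ hκ hadj
    rw [hr₂, Sym2.mem_iff] at this
    rw [hr₂, show ({j₀.1, j₁.1, s(α₂, β₂)} : Finset (Pair (m + 1))) = {j₁.1, j₀.1, s(α₂, β₂)} from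
      Finset.insert_comm _ _ _]
    refine this.imp_right (Or.imp_right ?_)
    rintro ((h | h) | h | h) <;> rw [h] <;> simp

theorem exists_isEdgePair_of_isSeparating (hsep : IsSeparating i A) (k : ZMod 2) :
    ∃ p ∈ side i k A, IsEdgePair p := by
  obtain ⟨α, β, α', β', h, h', he, he', hi, hi', hne⟩ := hsep
  have key : ∀ α β : Vert (m + 1), s(α, β) ∈ A → α i = β i → α i = k → s(α, β) ∈ side i k A := by
    intro α β h hi hk
    refine (mem_side i).2 ⟨h, fun v hv => ?_⟩
    rcases Sym2.mem_iff.1 hv with rfl | rfl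
    exacts [hk, hi ▸ hk]
  by_cases hk : α i = k
  · exact ⟨_, key α β h hi hk, he⟩
  · have hz : ∀ x y z : ZMod 2, x ≠ y → x ≠ z → y = z := by decide
    exact ⟨_, key α' β' h' hi' (hz _ _ _ hne hk), he'⟩

theorem exists_completion_of_card_le (hA : IsOdd A) (hm : 5 ≤ m) (hcard : A.card ≤ m)
    (h0 : (side i 0 A).card + 3 ≤ A.card) (h1 : (side i 1 A).card + 3 ≤ A.card)
    (h5 : m = 5 → A.card = 5 → ¬ ((side i 0 A).card = 0 ∧ (side i 1 A).card = 0)) :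
    ∃ B ∈ simpleCompletions i A, IsDiminishable (rho i 0 B) ∧ IsDiminishable (rho i 1 B) := by
  have hsum := card_eq_card_sides_add (A := A) i
  have hne : A.Nonempty := Finset.card_pos.1 (by omega)
  have hle : ∀ k, (side i k A).card + (cross i A).card ≤ m := by
    intro k
    rcases zmod_two_eq k with rfl | rfl <;> omega
  rcases hcard.lt_or_eq with hlt | heq
  · obtain ⟨g, hg, -⟩ := (CrossingData.valid_empty (D := crossingData i hA hm hle)
      fun _ => 0).exists_univ
    refine exists_completion_of_valid hA hm hle hne hg (t := 0) fun k hk => ?_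
    rcases zmod_two_eq k with rfl | rfl <;> omega
  · obtain ⟨g, hg, hgood⟩ := CrossingData.exists_good_two (D := crossingData i hA hm hle)
      (by rw [Fintype.card_coe]; exact hsum.symm.trans heq)
      (fun k => by
        change (side i k A).card + 3 ≤ m
        rcases zmod_two_eq k with rfl | rfl <;> omega)
      (fun h h' => by
        by_contra h6
        exact h5 (by omega) (by omega) ⟨h, h'⟩)
      (fun k hk => by
        have hk : side i k A = ∅ := Finset.card_eq_zero.1 hk
        change sideVerts i A k = ∅
        refine Finset.eq_empty_of_forall_notMem fun x hx => ?_
        obtain ⟨p, hp, -⟩ := (mem_sideVerts i).1 hx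
        rw [hk] at hp
        exact absurd hp (Finset.notMem_empty p))
    refine exists_completion_of_valid hA hm hle hne hg (t := 2) fun k hk => ?_
    have := hgood k (by rw [Fintype.card_coe]; exact hk)
    exact ⟨this, exists_isEdgePair_of_good_two hg this⟩

/-- As `i` is separating, a half with `m` pairs needs only one new edge-pair. -/
theorem exists_completion_of_card_eq (hA : IsOdd A) (hm : 5 ≤ m) (hcard : A.card = m + 1)
    (henc : enc (verts A) = ∅) (h0 : 1 ≤ (side i 0 A).card) (h1 : 1 ≤ (side i 1 A).card)
    (h0' : (side i 0 A).card + 3 ≤ m + 1) (h1' : (side i 1 A).card + 3 ≤ m + 1)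
    (hsep : IsSeparating i A) (hbad : ¬ IsBad i A) :
    ∃ B ∈ simpleCompletions i A, IsDiminishable (rho i 0 B) ∧ IsDiminishable (rho i 1 B) := by
  have hsum := card_eq_card_sides_add (A := A) i
  have hne : A.Nonempty := Finset.card_pos.1 (by omega)
  have hle : ∀ k, (side i k A).card + (cross i A).card ≤ m := by
    intro k
    rcases zmod_two_eq k with rfl | rfl <;> omega
  obtain ⟨g, hg, hgood⟩ := CrossingData.exists_good_one (D := crossingData i hA hm hle)
    (by rw [Fintype.card_coe]; exact hsum.symm.trans hcard)
    (fun k => by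
      change 1 ≤ (side i k A).card
      rcases zmod_two_eq k with rfl | rfl <;> omega)
    (fun k => by
      change (side i k A).card + 2 ≤ m
      rcases zmod_two_eq k with rfl | rfl <;> omega)
    (mem_U_of_enc_eq_empty henc)
    (fun k hk hs => exists_nbr_of_not_isBad hcard hsep hbad k hk (by rwa [Fintype.card_coe] at hs))
  refine exists_completion_of_valid hA hm hle hne hg (t := 1) fun k hk => ?_
  have := hgood k (by rw [Fintype.card_coe]; exact hk)
  exact ⟨this, exists_isEdgePair_of_good_one hg this (exists_isEdgePair_of_isSeparating hsep k)⟩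

/-- In even dimension, antipodal vertices have equal parity. -/
theorem exists_apply_eq_of_isOddPair {α β : Vert 6} (h : IsOddPair s(α, β)) : ∃ i, α i = β i := by
  by_contra! hcon
  refine h ?_
  have hβ : ∀ x y : ZMod 2, x ≠ y → (-1 : ℤ) ^ x.val = -(-1) ^ y.val := by decide
  unfold parity
  rw [Finset.prod_congr rfl fun i _ => hβ _ _ (hcon i), Finset.prod_neg]
  simp

end Assembly

end HypercubePairs

open HypercubePairs
theorem mainTheorem3 :
    (∀ (m : ℕ) (i : Fin (m + 1)) (A : Finset (Pair (m + 1))) (n₀ n₁ : ℕ),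
      6 ≤ m + 1 → IsDiminishable A → sigma i A = (n₀, n₁) →
      ((A.card ≤ m ∧ n₀ + 3 ≤ A.card ∧ n₁ + 3 ≤ A.card ∧
          (m + 1 = 6 → A.card = 5 → sigma i A ≠ (0, 0))) ∨
        (A.card = m + 1 ∧ 1 ≤ n₀ ∧ 1 ≤ n₁ ∧ n₀ + 3 ≤ m + 1 ∧ n₁ + 3 ≤ m + 1 ∧
          IsSeparating i A ∧ ¬ IsBad i A)) →
      ∃ B ∈ simpleCompletions i A, IsDiminishable (rho i 0 B) ∧ IsDiminishable (rho i 1 B)) ∧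
    (∀ A : Finset (Pair 6), IsDiminishable A → A.card = 5 →
      ∃ i : Fin 6, 3 ≤ max (sigma i A).1 (sigma i A).2 ∨
        ∃ B ∈ simpleCompletions i A,
          IsDiminishable (rho i 0 B) ∧ IsDiminishable (rho i 1 B)) := by
  constructor
  · rintro m i A n₀ n₁ hm ⟨hA, hdim⟩ hσ (⟨hcard, h0, h1, h5⟩ | ⟨hcard, h0, h1, h0', h1', hsep, hbad⟩)
    all_goals
      obtain ⟨rfl, rfl⟩ := Prod.mk.inj hσ
    · exact exists_completion_of_card_le hA (by omega) hcard h0 h1 fun hm5 hA5 h00 =>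
        h5 (by omega) hA5 (Prod.ext h00.1 h00.2)
    · rcases hdim with ⟨h, -⟩ | ⟨-, -, -, henc⟩
      · omega
      · exact exists_completion_of_card_eq hA (by omega) hcard henc h0 h1 h0' h1' hsep hbad
  · rintro A ⟨hA, -⟩ hcard
    obtain ⟨p, hp⟩ : A.Nonempty := Finset.card_pos.1 (by omega)
    obtain ⟨α, β, rfl⟩ : ∃ α β, p = s(α, β) := by
      induction p using Sym2.ind with
      | _ x y => exact ⟨x, y, rfl⟩
    obtain ⟨i, hi⟩ := exists_apply_eq_of_isOddPair (hA.2 _ hp)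
    refine ⟨i, or_iff_not_imp_left.2 fun hmax => ?_⟩
    simp only [sigma, le_max_iff, not_or, not_le] at hmax
    refine exists_completion_of_card_le hA le_rfl hcard.le (by omega) (by omega) fun _ _ h00 => ?_
    have key : s(α, β) ∈ side i (α i) A := by
      refine (mem_side i).2 ⟨hp, fun v hv => ?_⟩
      rcases Sym2.mem_iff.1 hv with rfl | rfl
      exacts [rfl, hi.symm]
    have hpos := Finset.card_pos.2 ⟨_, key⟩
    rcases zmod_two_eq (α i) with h | h <;> rw [h] at hpos <;> omega
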